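/- Let $\mathbb C^{\pm}=\{z\in\mathbb C:\pm\operatorname{Im} z>0\}$. For a probability measure $\mu$ on $\mathbb R$ let $G_\mu(z)=\int_{\mathbb R}\frac{1}{z-x}\,\mu(dx)$ be its Cauchy transform and $F_\mu=1/G_\mu$ on $\mathbb C^+$ its reciprocal Cauchy transform; $\mu$ is said to be in class $\mathbf{UI}$ if there is a domain $\Omega\subseteq\mathbb C$ with $\mathbb C^+\subseteq\Omega$ such that $F_\mu$ extends to an analytic bijection from $\Omega$ onto $\mathbb C^+$. The function $G_{N(0,1)}|_{\mathbb C^+}$ extends to an entire function, namely $$\widetilde G(z)=e^{-z^2/2}\Big[-i\sqrt{\tfrac{\pi}{2}}+\sqrt2\int_0^{z/\sqrt2}e^{t^2}\,dt\Big],\qquad z\in\mathbb C,$$ and $\widetilde F:=1/\widetilde G$ is a meromorphic function on $\mathbb C$. Let $\Xi=\{x+iy: y\ge 0 \text{ or } |2xy|<\pi\}$. For every $x>0$ there is a unique point $H(x)\in\Xi$ with $\operatorname{Im} H(x)<0$, $\operatorname{Re} H(x)>0$ and $\widetilde F(H(x))=x$. Put $g(x)=\operatorname{Re}H(x)$ and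 $h(x)=-\operatorname{Im}H(x)$ for $x>0$; $g$ is a bijection of $(0,\infty)$ onto itself. Define $f(x)=-h(g^{-1}(|x|))$ for $x\in\mathbb R\setminus\{0\}$, and $$\Omega=\{x+iy:\ x,y\in\mathbb R,\ x\ne0,\ y>f(x)\}\cup i\mathbb R.$$ Then $f$ is real analytic and negative on $\mathbb R\setminus\{0\}$; $\Omega$ is a domain containing $\mathbb C^+$, and $\widetilde F$, which extends $F_{N(0,1)}$, is analytic on $\Omega$ and maps $\Omega$ bijectively onto $\mathbb C^+$, so that $N(0,1)$ is in class $\mathbf{UI}$. Moreover, $\widetilde F$ has no poles on the closure $\operatorname{cl}(\Omega)$ and is a homeomorphism from $\operatorname{cl}(\Omega)$ onto $(\mathbb C^+\cup\mathbb R)\setminus\{0\}$. -/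

import Mathlib

open MeasureTheory ProbabilityTheory Set

noncomputable section

namespace NormalUI

/-- The open upper half-plane, as a subset of `ℂ`. -/
def upperHalf : Set ℂ := {z | 0 < z.im}

/-- The Cauchy transform `G_μ(z) = ∫ 1 / (z - x) μ(dx)` (meaningful for `z ∉ ℝ`). -/
def cauchyTransform (μ : Measure ℝ) (z : ℂ) : ℂ := ∫ x : ℝ, 1 / (z - (x : ℂ)) ∂μ

/-- The reciprocal Cauchy transform `F_μ = 1 / G_μ` (meaningful on the upper half-plane). -/
def recipCauchyTransform (μ : Measure ℝ) (z : ℂ) : ℂ := 1 / cauchyTransform μ z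

/-- `Ω` is a domain containing the upper half-plane and `F` is an extension of `F_μ` which is
an analytic bijection from `Ω` onto the upper half-plane. -/
structure IsUIExtension (μ : Measure ℝ) (Ω : Set ℂ) (F : ℂ → ℂ) : Prop where
  isOpen : IsOpen Ω
  isConnected : IsConnected Ω
  upperHalf_subset : upperHalf ⊆ Ω
  eqOn : EqOn F (recipCauchyTransform μ) upperHalf
  analytic : AnalyticOnNhd ℂ F Ω
  bijOn : BijOn F Ω upperHalf

/-- The class **UI** of probability measures on `ℝ`. -/
def ClassUI (μ : Measure ℝ) [IsProbabilityMeasure μ] : Prop :=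
  ∃ (Ω : Set ℂ) (F : ℂ → ℂ), IsUIExtension μ Ω F

/-- The entire function `e^{-z²/2} (-i √(π/2) + √2 ∫_0^{z/√2} e^{t²} dt)`; the integral is taken
along the segment from `0` to `z/√2`. -/
def GTilde (z : ℂ) : ℂ :=
  Complex.exp (-z ^ 2 / 2) *
    (-Complex.I * (Real.sqrt (Real.pi / 2) : ℂ) +
      (Real.sqrt 2 : ℂ) *
        ((z / (Real.sqrt 2 : ℂ)) *
          ∫ s in (0 : ℝ)..1, Complex.exp (((s : ℂ) * (z / (Real.sqrt 2 : ℂ))) ^ 2)))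

/-- The meromorphic function `1 / GTilde`. -/
def FTilde (z : ℂ) : ℂ := 1 / GTilde z

/-- The domain lying above the two curves `2xy = ±π` in the lower half-plane. -/
def Xi : Set ℂ := {z | 0 ≤ z.im ∨ |2 * z.re * z.im| < Real.pi}

/-- `z` is a solution of `FTilde z = x` in the part of `Xi` with `Re z > 0` and `Im z < 0`. -/
def IsBoundaryPoint (x : ℝ) (z : ℂ) : Prop :=
  z ∈ Xi ∧ z.im < 0 ∧ 0 < z.re ∧ FTilde z = (x : ℂ)

/-- The point `H(x)`, `x > 0`: the solution of `FTilde z = x` in `Xi ∩ {Im < 0} ∩ {Re > 0}`. -/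
def H (x : ℝ) : ℂ := Classical.epsilon (IsBoundaryPoint x)

/-- `g = Re H` on `(0, ∞)`. -/
def g (x : ℝ) : ℝ := (H x).re

/-- `h = -Im H` on `(0, ∞)`. -/
def h (x : ℝ) : ℝ := -(H x).im

/-- `f(x) = -h(g⁻¹(|x|))` for `x ≠ 0`, where `g⁻¹` is the inverse of `g` on `(0, ∞)`. -/
def f (x : ℝ) : ℝ := -h (Function.invFunOn g (Ioi 0) |x|)

/-- `Ω = {x + iy : x ≠ 0, y > f(x)} ∪ iℝ`. -/
def Omega : Set ℂ := {z | z.re ≠ 0 ∧ f z.re < z.im} ∪ {z | z.re = 0}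

end NormalUI

end

/-!
Write `G` for `GTilde` and `F = 1 / G`. The proof rests on the representation
`G(z) = -i ∫_0^∞ e^{izs - s²/2} ds`, valid for all complex `z`, on the equation `G' = 1 - zG`, and on
the reflection formula `G(z) = conj (G(conj z)) - i√(2π) e^{-z²/2}`.

*The boundary curve.* On a vertical line `Re z = x > 0` inside `Xi`, the function `Im G` is negative
on the upper half-plane and the real axis, and positive where `2xy = -π`. At a zero of `Im G` in
between, its vertical derivative is `1 - x Re G`, and this is negative
(`one_lt_re_mul_GTilde_re`): translating the integration variable `s` by `π / (2x)` bounds it by a positive multiple of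
`Im (ζ G(ζ))` at a point `ζ` of the first quadrant, where the Cauchy integral gives the sign. So
`Im G` vanishes exactly once on the line. The zeros form the graph of `f`, which is analytic by the
implicit function theorem, and `Omega = Xi ∩ {Im G < 0}`, with closure `Xi ∩ {Im G ≤ 0}`.

*Bijectivity.* On this closure `G' ≠ 0`, and `G` is proper as a map to `ℂ ∖ {0}`
(`exists_norm_le_of_norm_GTilde`). Hence `G` maps `Omega` onto the lower half-plane, and the set of
values attained exactly once is open and relatively closed there; it contains `G(0)`, as `G` is purely
imaginary only on the imaginary axis, where it is monotone. So `G` is injective on `Omega`.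
Injectivity on the closure follows because `G` is locally open at boundary points, and surjectivity
and continuity of the inverse follow from properness. Existence and uniqueness of `H(x)` are the
bijectivity of `F` on the closure at the value `x`.
-/

noncomputable section

namespace NormalUI

open Complex Filter Topology
open scoped ComplexConjugate ContDiff

/-! ### The one-sided Gaussian Laplace transform -/

/-- The weight `e^{izs - s²/2}`, whose integral over `s > 0` is `i G(z)`. -/
def kernel (z : ℂ) (s : ℝ) : ℂ := cexp (I * z * s - s ^ 2 / 2)

/-- The real weight `e^{ys - s²/2}`, the modulus of `kernel (x - iy)`. -/
def weight (y s : ℝ) : ℝ := Real.exp (y * s - s ^ 2 / 2)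

lemma norm_kernel (z : ℂ) (s : ℝ) : ‖kernel z s‖ = weight (-z.im) s := by
  simp [kernel, weight, Complex.norm_exp, ← ofReal_pow]

lemma weight_pos (y s : ℝ) : 0 < weight y s := Real.exp_pos _

lemma kernel_re (z : ℂ) (s : ℝ) :
    (kernel z s).re = Real.cos (z.re * s) * weight (-z.im) s := by
  simp [kernel, weight, Complex.exp_re, ← ofReal_pow, mul_comm]

lemma kernel_im (z : ℂ) (s : ℝ) :
    (kernel z s).im = Real.sin (z.re * s) * weight (-z.im) s := by
  simp [kernel, weight, Complex.exp_im, ← ofReal_pow, mul_comm]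

@[fun_prop]
lemma continuous_kernel (z : ℂ) : Continuous (kernel z) := by unfold kernel; fun_prop

@[fun_prop]
lemma continuous_weight (y : ℝ) : Continuous (weight y) := by unfold weight; fun_prop

lemma weight_le (y s : ℝ) : weight y s ≤ Real.exp (y ^ 2) * Real.exp (-(1 / 4) * s ^ 2) := by
  rw [weight, ← Real.exp_add]
  gcongr
  nlinarith [sq_nonneg (y - s / 2)]

lemma integrable_weight (y : ℝ) : Integrable (weight y) := by
  refine ((integrable_exp_neg_mul_sq (b := 1 / 4) (by norm_num)).const_mul
    (Real.exp (y ^ 2))).mono' (by fun_prop) (ae_of_all _ fun s ↦ ?_)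
  rw [Real.norm_of_nonneg (weight_pos y s).le]
  exact weight_le y s

lemma integrable_mul_weight (y : ℝ) : Integrable fun s : ℝ ↦ s * weight y s := by
  refine ((integrable_mul_exp_neg_mul_sq (b := 1 / 4) (by norm_num)).norm.const_mul
    (Real.exp (y ^ 2))).mono' (by fun_prop) (ae_of_all _ fun s ↦ ?_)
  rw [norm_mul, Real.norm_of_nonneg (weight_pos y s).le, norm_mul,
    Real.norm_of_nonneg (Real.exp_pos _).le]
  calc ‖s‖ * weight y s ≤ ‖s‖ * (Real.exp (y ^ 2) * Real.exp (-(1 / 4) * s ^ 2)) := by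
        gcongr; exact weight_le y s
    _ = _ := by ring

lemma integrable_kernel (z : ℂ) : Integrable (kernel z) :=
  (integrable_weight (-z.im)).mono' (by fun_prop) (ae_of_all _ fun s ↦ (norm_kernel z s).le)

lemma integrable_mul_kernel (z : ℂ) : Integrable fun s : ℝ ↦ (s : ℂ) * kernel z s :=
  (integrable_mul_weight (-z.im)).norm.mono' (by fun_prop) (ae_of_all _ fun s ↦ by
    rw [norm_mul, norm_kernel, norm_mul, Real.norm_of_nonneg (weight_pos _ _).le, norm_real])

/-- The entire function `-i ∫_0^∞ e^{izs - s²/2} ds`; it turns out to be `GTilde`. -/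
def laplaceG (z : ℂ) : ℂ := -I * ∫ s in Ioi (0 : ℝ), kernel z s

lemma hasDerivAt_laplaceG_integral (z : ℂ) :
    HasDerivAt laplaceG (∫ s in Ioi (0 : ℝ), (s : ℂ) * kernel z s) z := by
  have key := (hasDerivAt_integral_of_dominated_loc_of_deriv_le
    (μ := volume.restrict (Ioi (0 : ℝ))) (F := kernel) (x₀ := z)
    (F' := fun w (s : ℝ) ↦ I * ((s : ℂ) * kernel w s)) (s := Metric.ball z 1)
    (bound := fun s ↦ s * weight (-z.im + 1) s) (Metric.ball_mem_nhds z one_pos)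
    (Eventually.of_forall fun w ↦ (continuous_kernel w).aestronglyMeasurable)
    (integrable_kernel z).integrableOn
    (by fun_prop) ?_ (integrable_mul_weight _).integrableOn ?_).2
  · have := key.const_mul (-I)
    rw [integral_const_mul, ← mul_assoc, neg_mul, I_mul_I, neg_neg, one_mul] at this
    exact this
  · refine (ae_restrict_mem measurableSet_Ioi).mono fun s (hs : 0 < s) w hw ↦ ?_
    rw [norm_mul, norm_mul, norm_I, one_mul, norm_real, Real.norm_of_nonneg hs.le, norm_kernel]
    unfold weight
    gcongr
    have := (abs_im_le_norm (w - z)).trans (mem_ball_iff_norm.1 hw).le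
    rw [sub_im, abs_le] at this
    linarith
  · refine ae_of_all _ fun s w _ ↦ ?_
    have : HasDerivAt (fun w : ℂ ↦ I * w * s - (s : ℂ) ^ 2 / 2) (I * s) w := by
      simpa using (((hasDerivAt_id w).const_mul I).mul_const (s : ℂ)).sub_const ((s : ℂ) ^ 2 / 2)
    convert! this.cexp using 1
    simp only [kernel]; ring

lemma tendsto_weight_atTop (y : ℝ) : Tendsto (weight y) atTop (𝓝 0) := by
  have h1 : Tendsto (fun s : ℝ ↦ s * (s / 2 - y)) atTop atTop :=
    tendsto_id.atTop_mul_atTop₀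
      (tendsto_atTop_add_const_right _ (-y) (tendsto_id.atTop_div_const two_pos))
  refine (Real.tendsto_exp_neg_atTop_nhds_zero.comp h1).congr fun s ↦ ?_
  simp only [Function.comp, weight]
  congr 1; ring

/-- Integration by parts. -/
lemma integral_mul_kernel (z : ℂ) :
    ∫ s in Ioi (0 : ℝ), (s : ℂ) * kernel z s = 1 - z * laplaceG z := by
  have hd (s : ℝ) : HasDerivAt (kernel z) (I * z * kernel z s - s * kernel z s) s := by
    have h0 : HasDerivAt (fun s : ℝ ↦ (s : ℂ)) 1 s := ofRealCLM.hasDerivAt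
    have : HasDerivAt (fun s : ℝ ↦ I * z * s - (s : ℂ) ^ 2 / 2) (I * z - s) s := by
      convert! (h0.const_mul (I * z)).sub ((h0.pow 2).div_const 2) using 1
      simp
    convert! this.cexp using 1
    simp only [kernel]; ring
  have hint : Integrable fun s : ℝ ↦ I * z * kernel z s - s * kernel z s :=
    ((integrable_kernel z).const_mul _).sub (integrable_mul_kernel z)
  have hlim : Tendsto (kernel z) atTop (𝓝 0) := by
    rw [tendsto_zero_iff_norm_tendsto_zero]
    simpa only [norm_kernel] using tendsto_weight_atTop (-z.im)
  have h := integral_Ioi_of_hasDerivAt_of_tendsto (a := 0)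
    (continuous_kernel z).continuousWithinAt (fun s _ ↦ hd s) hint.integrableOn hlim
  rw [integral_sub ((integrable_kernel z).const_mul _).integrableOn
    (integrable_mul_kernel z).integrableOn, integral_const_mul] at h
  have h0 : kernel z 0 = 1 := by simp [kernel]
  rw [h0] at h
  simp only [laplaceG]
  linear_combination -h

lemma hasDerivAt_laplaceG (z : ℂ) : HasDerivAt laplaceG (1 - z * laplaceG z) z :=
  integral_mul_kernel z ▸ hasDerivAt_laplaceG_integral z

/-- `e^{z²/2} laplaceG z` is a primitive of `e^{z²/2}`, and so is the bracket in the definition of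
`GTilde`; the two agree at `0`. -/
lemma GTilde_eq_laplaceG : GTilde = laplaceG := by
  ext z
  have h2 : (Real.sqrt 2 : ℂ) ^ 2 = 2 := by exact_mod_cast Real.sq_sqrt (by norm_num : (0:ℝ) ≤ 2)
  have h2' : (Real.sqrt 2 : ℂ) ≠ 0 := by
    exact_mod_cast (Real.sqrt_pos.2 (by norm_num : (0:ℝ) < 2)).ne'
  have hE (w : ℂ) : HasDerivAt (fun w ↦ cexp (w ^ 2 / 2) * laplaceG w) (cexp (w ^ 2 / 2)) w := by
    have h1 : HasDerivAt (fun w : ℂ ↦ w ^ 2 / 2) w w := by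
      simpa using ((hasDerivAt_id w).pow 2).div_const 2
    convert! h1.cexp.mul (hasDerivAt_laplaceG w) using 1
    ring
  have hd (s : ℝ) : HasDerivAt (fun s : ℝ ↦ cexp (((s : ℂ) * z) ^ 2 / 2) * laplaceG (s * z))
      (z * cexp (((s : ℂ) * z) ^ 2 / 2)) s := by
    have h0 : HasDerivAt (fun s : ℝ ↦ (s : ℂ) * z) z s := by
      simpa using (ofRealCLM.hasDerivAt (x := s)).mul_const z
    have := (hE ((s : ℂ) * z)).scomp s h0
    simpa [Function.comp_def] using this
  have hint := intervalIntegral.integral_eq_sub_of_hasDerivAt (a := 0) (b := 1)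
    (fun s _ ↦ hd s) (Continuous.intervalIntegrable (by fun_prop) _ _)
  rw [intervalIntegral.integral_const_mul] at hint
  have hG0 : laplaceG 0 = -I * (Real.sqrt (Real.pi / 2) : ℂ) := by
    have hk (s : ℝ) : kernel 0 s = (Real.exp (-(1 / 2) * s ^ 2) : ℝ) := by
      simp only [kernel]; push_cast; congr 1; ring
    simp_rw [laplaceG, hk]
    rw [integral_complex_ofReal, integral_gaussian_Ioi]
    congr 2
    rw [show Real.pi / (1 / 2) = Real.pi / 2 * 2 ^ 2 by ring,
      Real.sqrt_mul (by positivity), Real.sqrt_sq (by norm_num)]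
    ring
  have hcongr : ∫ s in (0 : ℝ)..1, cexp (((s : ℂ) * (z / (Real.sqrt 2 : ℂ))) ^ 2) =
      ∫ s in (0 : ℝ)..1, cexp (((s : ℂ) * z) ^ 2 / 2) := by
    congr 1 with s
    rw [← mul_div_assoc, div_pow, h2]
  have hexp : cexp (-z ^ 2 / 2) * cexp (z ^ 2 / 2) = 1 := by
    rw [← Complex.exp_add, neg_div, neg_add_cancel, Complex.exp_zero]
  simp only [ofReal_one, one_mul, ofReal_zero, zero_mul, hG0] at hint
  rw [GTilde, hcongr, div_mul_eq_mul_div, hint]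
  simp only [ne_eq, OfNat.ofNat_ne_zero, not_false_eq_true, zero_pow, zero_div, Complex.exp_zero,
    one_mul]
  rw [mul_div_cancel₀ _ h2']
  linear_combination laplaceG z * hexp

lemma GTilde_eq (z : ℂ) : GTilde z = -I * ∫ s in Ioi (0 : ℝ), kernel z s := by
  rw [GTilde_eq_laplaceG, laplaceG]

lemma hasDerivAt_GTilde (z : ℂ) : HasDerivAt GTilde (1 - z * GTilde z) z := by
  rw [GTilde_eq_laplaceG]; exact hasDerivAt_laplaceG z

lemma differentiable_GTilde : Differentiable ℂ GTilde :=
  fun z ↦ (hasDerivAt_GTilde z).differentiableAt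

@[fun_prop]
lemma continuous_GTilde : Continuous GTilde := differentiable_GTilde.continuous

lemma one_sub_mul_GTilde (z : ℂ) :
    1 - z * GTilde z = ∫ s in Ioi (0 : ℝ), (s : ℂ) * kernel z s := by
  rw [GTilde_eq_laplaceG, integral_mul_kernel]

/-! ### The Cauchy transform on the upper half-plane -/

/-- Write `1 / (z - u) = -i ∫_0^∞ e^{i(z - u)s} ds` and exchange the integrals: the Gaussian
integral over `u` gives the characteristic function `e^{-s²/2}`. -/
lemma GTilde_eq_cauchyTransform {z : ℂ} (hz : 0 < z.im) :
    GTilde z = cauchyTransform (gaussianReal 0 1) z := by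
  have h1 (u : ℝ) : 1 / (z - u) = -I * ∫ s in Ioi (0 : ℝ), cexp (I * (z - u) * s) := by
    have hne : z - u ≠ 0 := fun h ↦ hz.ne' (by simpa using congrArg im h)
    rw [integral_exp_mul_complex_Ioi (by simpa using hz)]
    simp only [ofReal_zero, mul_zero, Complex.exp_zero]
    field_simp
  have hint : Integrable (Function.uncurry fun (u s : ℝ) ↦ cexp (I * (z - u) * s))
      ((gaussianReal 0 1).prod (volume.restrict (Ioi 0))) := by
    have hb : Integrable (fun p : ℝ × ℝ ↦ (1 : ℝ) * Real.exp (-z.im * p.2))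
        ((gaussianReal 0 1).prod (volume.restrict (Ioi 0))) :=
      (integrable_const (1 : ℝ)).mul_prod (integrableOn_exp_mul_Ioi (by simpa using hz) 0)
    refine hb.mono' (Continuous.aestronglyMeasurable (by unfold Function.uncurry; fun_prop))
      (ae_of_all _ fun p ↦ ?_)
    simp [Function.uncurry, Complex.norm_exp]
  have h2 (s : ℝ) : ∫ u : ℝ, cexp (I * (z - u) * s) ∂(gaussianReal 0 1) = kernel z s := by
    have := charFun_gaussianReal (μ := 0) (v := 1) (-s)
    rw [charFun_apply_real] at this
    have h3 (u : ℝ) : cexp (I * (z - u) * s) = cexp (I * z * s) * cexp ((-s : ℝ) * u * I) := by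
      rw [← Complex.exp_add]; congr 1; push_cast; ring
    simp_rw [h3]
    rw [integral_const_mul, this, ← Complex.exp_add, kernel]
    congr 1; push_cast; ring
  rw [GTilde_eq, cauchyTransform]
  simp_rw [h1]
  rw [integral_const_mul, integral_integral_swap hint]
  simp_rw [h2]

/-! ### Symmetries and signs of the transform -/

lemma GTilde_neg_conj (z : ℂ) : GTilde (-conj z) = -conj (GTilde z) := by
  have hk (s : ℝ) : kernel (-conj z) s = conj (kernel z s) := by
    simp only [kernel, ← Complex.exp_conj]
    congr 1
    simp [map_ofNat]
  rw [GTilde_eq, GTilde_eq]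
  simp_rw [hk]
  rw [integral_conj]
  simp

lemma GTilde_add_GTilde_neg (z : ℂ) :
    GTilde z + GTilde (-z) = -(2 * I * (Real.sqrt (Real.pi / 2) : ℂ) * cexp (-z ^ 2 / 2)) := by
  have h (s : ℝ) : ((s : ℂ) * (-z / (Real.sqrt 2 : ℂ))) ^ 2 =
      ((s : ℂ) * (z / (Real.sqrt 2 : ℂ))) ^ 2 := by ring
  unfold GTilde
  simp_rw [h, neg_sq]
  ring

/-- The reflection formula across the real axis: `conj (G (conj z))` is the Cauchy transform on the
lower half-plane, and differs from the continuation `G` by an elementary term. -/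
lemma GTilde_eq_conj_sub (z : ℂ) :
    GTilde z = conj (GTilde (conj z)) -
      2 * I * (Real.sqrt (Real.pi / 2) : ℂ) * cexp (-z ^ 2 / 2) := by
  have h1 := GTilde_add_GTilde_neg z
  have h2 := GTilde_neg_conj (conj z)
  rw [conj_conj] at h2
  rw [h2] at h1
  linear_combination h1

/-- The modulus of the elementary term in the reflection formula. -/
def jump (z : ℂ) : ℝ :=
  2 * Real.sqrt (Real.pi / 2) * Real.exp ((z.im ^ 2 - z.re ^ 2) / 2)

lemma jump_pos (z : ℂ) : 0 < jump z := by
  have := Real.pi_pos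
  unfold jump; positivity

lemma neg_sq_div_two_re_im (z : ℂ) : (-z ^ 2 / 2).re = (z.im ^ 2 - z.re ^ 2) / 2 ∧
    (-z ^ 2 / 2).im = -(z.re * z.im) := by
  constructor
  · simp [pow_two]
  · simp [pow_two]; ring

lemma GTilde_re_reflect (z : ℂ) :
    (GTilde z).re = (GTilde (conj z)).re - jump z * Real.sin (z.re * z.im) := by
  conv_lhs => rw [GTilde_eq_conj_sub z]
  have h := neg_sq_div_two_re_im z
  simp [Complex.exp_im, Complex.exp_re, h.1, h.2, jump]
  ring

lemma GTilde_im_reflect (z : ℂ) :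
    (GTilde z).im = -(GTilde (conj z)).im - jump z * Real.cos (z.re * z.im) := by
  conv_lhs => rw [GTilde_eq_conj_sub z]
  have h := neg_sq_div_two_re_im z
  simp [Complex.exp_im, Complex.exp_re, h.1, h.2, jump]
  ring

lemma GTilde_im_eq_integral (z : ℂ) :
    (GTilde z).im = -∫ s in Ioi (0 : ℝ), Real.cos (z.re * s) * weight (-z.im) s := by
  have h := reCLM.integral_comp_comm (integrable_kernel z).integrableOn (μ := volume.restrict (Ioi 0))
  simp only [reCLM_apply, kernel_re] at h
  rw [GTilde_eq, h]
  simp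

lemma GTilde_re_eq_integral (z : ℂ) :
    (GTilde z).re = ∫ s in Ioi (0 : ℝ), Real.sin (z.re * s) * weight (-z.im) s := by
  have h := imCLM.integral_comp_comm (integrable_kernel z).integrableOn (μ := volume.restrict (Ioi 0))
  simp only [imCLM_apply, kernel_im] at h
  rw [GTilde_eq, h]
  simp

lemma integrable_cos_mul_weight (x y : ℝ) :
    Integrable fun s ↦ Real.cos (x * s) * weight y s :=
  (integrable_weight y).bdd_mul (c := 1) (by fun_prop)
    (ae_of_all _ fun s ↦ Real.abs_cos_le_one _)

lemma integrable_mul_cos_mul_weight (x y : ℝ) :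
    Integrable fun s ↦ s * (Real.cos (x * s) * weight y s) := by
  refine ((integrable_mul_weight y).bdd_mul (c := 1) (f := fun s ↦ Real.cos (x * s)) (by fun_prop)
    (ae_of_all _ fun s ↦ Real.abs_cos_le_one _)).congr (ae_of_all _ fun s ↦ ?_)
  simp only; ring

lemma re_one_sub_mul_GTilde (z : ℂ) : (1 - z * GTilde z).re =
    ∫ s in Ioi (0 : ℝ), s * (Real.cos (z.re * s) * weight (-z.im) s) := by
  have h := reCLM.integral_comp_comm (integrable_mul_kernel z).integrableOn
    (μ := volume.restrict (Ioi 0))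
  simp only [reCLM_apply, re_ofReal_mul, kernel_re] at h
  rw [one_sub_mul_GTilde, h]

lemma im_one_sub_mul_GTilde (z : ℂ) : (1 - z * GTilde z).im =
    ∫ s in Ioi (0 : ℝ), s * (Real.sin (z.re * s) * weight (-z.im) s) := by
  have h := imCLM.integral_comp_comm (integrable_mul_kernel z).integrableOn
    (μ := volume.restrict (Ioi 0))
  simp only [imCLM_apply, im_ofReal_mul, kernel_im] at h
  rw [one_sub_mul_GTilde, h]

/-- The combination of the real part of `1 - z G(z)` with `Im z * Im G(z)` that eliminates
`Im G(z)`. -/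
lemma one_sub_re_mul_re (z : ℂ) : 1 - z.re * (GTilde z).re =
    ∫ s in Ioi (0 : ℝ), (s + z.im) * (Real.cos (z.re * s) * weight (-z.im) s) := by
  simp_rw [add_mul]
  rw [integral_add (integrable_mul_cos_mul_weight _ _).integrableOn
    ((integrable_cos_mul_weight _ _).const_mul _).integrableOn, integral_const_mul,
    ← re_one_sub_mul_GTilde]
  have := GTilde_im_eq_integral z
  simp only [sub_re, one_re, mul_re]
  linear_combination -z.im * this

lemma setIntegral_Ioi_pos {F : ℝ → ℝ} {b : ℝ} (hF : IntegrableOn F (Ioi 0))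
    (h0 : ∀ s, 0 < s → 0 ≤ F s) (hb : 0 < b) (h1 : ∀ s ∈ Ioo 0 b, 0 < F s) :
    0 < ∫ s in Ioi (0 : ℝ), F s := by
  rw [setIntegral_pos_iff_support_of_nonneg_ae
    ((ae_restrict_mem measurableSet_Ioi).mono fun s hs ↦ h0 s hs) hF]
  refine lt_of_lt_of_le ?_ (measure_mono (s := Ioo 0 b) fun s hs ↦ ⟨(h1 s hs).ne', hs.1⟩)
  simpa using hb

lemma GTilde_im_neg_of_re_eq_zero {z : ℂ} (hz : z.re = 0) : (GTilde z).im < 0 := by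
  rw [GTilde_im_eq_integral, neg_lt_zero]
  refine setIntegral_Ioi_pos (integrable_cos_mul_weight _ _).integrableOn (fun s _ ↦ ?_) one_pos
    (fun s _ ↦ ?_)
  all_goals
    have := weight_pos (-z.im) s
    simp only [hz, zero_mul, Real.cos_zero, one_mul]
    linarith

lemma GTilde_re_of_re_eq_zero {z : ℂ} (hz : z.re = 0) : (GTilde z).re = 0 := by
  rw [GTilde_re_eq_integral]; simp [hz]

lemma one_sub_mul_GTilde_re_pos_of_re_eq_zero {z : ℂ} (hz : z.re = 0) :
    0 < (1 - z * GTilde z).re := by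
  rw [re_one_sub_mul_GTilde]
  refine setIntegral_Ioi_pos (integrable_mul_cos_mul_weight _ _).integrableOn (fun s hs ↦ ?_)
    one_pos (fun s hs ↦ ?_)
  all_goals
    have := weight_pos (-z.im) s
    simp only [hz, zero_mul, Real.cos_zero, one_mul]
  · positivity
  · exact mul_pos hs.1 this

/-- Since `∫ (s + y) e^{-ys - s²/2} ds = 1`, one has
`x Re G(x + iy) = ∫ (s + y) (1 - cos (xs)) e^{-ys - s²/2} ds`. -/
lemma GTilde_re_pos_of_im_nonneg {z : ℂ} (hx : 0 < z.re) (hy : 0 ≤ z.im) :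
    0 < (GTilde z).re := by
  have h1 := one_sub_re_mul_re z
  have h2 := one_sub_re_mul_re (z.im * I)
  simp only [mul_re, ofReal_re, I_re, mul_zero, ofReal_im, I_im, mul_one, sub_self, zero_mul,
    sub_zero, mul_im, add_zero, Real.cos_zero, one_mul] at h2
  have hi1 : Integrable fun s ↦ (s + z.im) * (Real.cos (z.re * s) * weight (-z.im) s) := by
    simp only [add_mul]
    exact (integrable_mul_cos_mul_weight z.re (-z.im)).add
      ((integrable_cos_mul_weight z.re (-z.im)).const_mul z.im)
  have hi2 : Integrable fun s ↦ (s + z.im) * weight (-z.im) s := by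
    simp only [add_mul]
    exact (integrable_mul_weight (-z.im)).add
      ((integrable_weight (-z.im)).const_mul z.im)
  have h3 : z.re * (GTilde z).re = ∫ s in Ioi (0 : ℝ), ((s + z.im) * weight (-z.im) s -
      (s + z.im) * (Real.cos (z.re * s) * weight (-z.im) s)) := by
    rw [integral_sub hi2.integrableOn hi1.integrableOn, ← h1, ← h2]
    ring
  have h4 : 0 < z.re * (GTilde z).re := by
    rw [h3]
    refine setIntegral_Ioi_pos (hi2.sub hi1).integrableOn (fun s hs ↦ ?_)
      (b := Real.pi / z.re) (by positivity) (fun s hs ↦ ?_)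
    · have : (s + z.im) * weight (-z.im) s - (s + z.im) * (Real.cos (z.re * s) * weight (-z.im) s)
        = (s + z.im) * weight (-z.im) s * (1 - Real.cos (z.re * s)) := by ring
      rw [this]
      have := Real.cos_le_one (z.re * s)
      have := weight_pos (-z.im) s
      exact mul_nonneg (by positivity) (by linarith)
    · have : (s + z.im) * weight (-z.im) s - (s + z.im) * (Real.cos (z.re * s) * weight (-z.im) s)
        = (s + z.im) * weight (-z.im) s * (1 - Real.cos (z.re * s)) := by ring
      rw [this]
      have hs0 := hs.1
      have hlt : Real.cos (z.re * s) < Real.cos 0 :=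
        Real.cos_lt_cos_of_nonneg_of_le_pi le_rfl ((lt_div_iff₀' hx).1 hs.2).le (mul_pos hx hs.1)
      rw [Real.cos_zero] at hlt
      have := weight_pos (-z.im) s
      exact mul_pos (by positivity) (by linarith)
  exact pos_of_mul_pos_right h4 hx.le

lemma norm_inv_sub_le {z : ℂ} (hz : 0 < z.im) (u : ℝ) : ‖1 / (z - u)‖ ≤ 1 / z.im := by
  rw [norm_div, norm_one]
  gcongr
  simpa using (le_abs_self _).trans (abs_im_le_norm (z - u))

lemma integrable_inv_sub {z : ℂ} (hz : 0 < z.im) :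
    Integrable (fun u : ℝ ↦ 1 / (z - u)) (gaussianReal 0 1) :=
  (integrable_const (1 / z.im)).mono' (by measurability) (ae_of_all _ (norm_inv_sub_le hz))

lemma im_inv_sub (z : ℂ) (u : ℝ) :
    (1 / (z - u)).im = -(z.im / ((z.re - u) ^ 2 + z.im ^ 2)) := by
  simp [normSq_apply]; ring

lemma re_inv_sub (z : ℂ) (u : ℝ) :
    (1 / (z - u)).re = (z.re - u) / ((z.re - u) ^ 2 + z.im ^ 2) := by
  simp [normSq_apply]; ring

lemma GTilde_im_neg_of_im_pos {z : ℂ} (hz : 0 < z.im) : (GTilde z).im < 0 := by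
  have h := imCLM.integral_comp_comm (integrable_inv_sub hz)
  simp only [imCLM_apply, im_inv_sub] at h
  rw [GTilde_eq_cauchyTransform hz, cauchyTransform, ← h, integral_neg, neg_lt_zero]
  have hpos (u : ℝ) : 0 < z.im / ((z.re - u) ^ 2 + z.im ^ 2) := by positivity
  have hint : Integrable (fun u : ℝ ↦ z.im / ((z.re - u) ^ 2 + z.im ^ 2)) (gaussianReal 0 1) := by
    refine (imCLM.integrable_comp (integrable_inv_sub hz)).neg.congr (ae_of_all _ fun u ↦ ?_)
    simp only [Pi.neg_apply, imCLM_apply, im_inv_sub, neg_neg]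
  rw [integral_pos_iff_support_of_nonneg (fun u ↦ (hpos u).le) hint,
    Function.support_eq_univ fun u ↦ (hpos u).ne']
  simp

lemma GTilde_im_neg_of_im_nonneg {z : ℂ} (hz : 0 ≤ z.im) : (GTilde z).im < 0 := by
  rcases hz.lt_or_eq with hz | hz
  · exact GTilde_im_neg_of_im_pos hz
  · have h := GTilde_im_reflect z
    have hc : conj z = z := conj_eq_iff_im.2 hz.symm
    rw [hc, ← hz, mul_zero, Real.cos_zero] at h
    linarith [jump_pos z]

/-- In the open first quadrant `Im (z G(z)) = -∫ u y / |z - u|² dγ(u)`, and pairing `u` with `-u`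
shows that the integral is positive. -/
lemma mul_GTilde_im_neg_of_pos {z : ℂ} (hx : 0 < z.re) (hy : 0 < z.im) :
    (z * GTilde z).im < 0 := by
  set k : ℝ → ℝ := fun u ↦ u * (z.im / ((z.re - u) ^ 2 + z.im ^ 2)) with hk
  have him (u : ℝ) : (z * (1 / (z - u))).im = -k u := by
    have : 0 < (z.re - u) ^ 2 + z.im ^ 2 := by positivity
    rw [mul_im, im_inv_sub, re_inv_sub, hk]
    field_simp
    ring
  have hint : Integrable k (gaussianReal 0 1) := by
    refine (imCLM.integrable_comp ((integrable_inv_sub hy).const_mul z)).neg.congr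
      (ae_of_all _ fun u ↦ ?_)
    simp only [Pi.neg_apply, imCLM_apply, him, neg_neg]
  have h := imCLM.integral_comp_comm ((integrable_inv_sub hy).const_mul z)
  simp only [imCLM_apply, him, integral_neg, integral_const_mul] at h
  rw [GTilde_eq_cauchyTransform hy, cauchyTransform, ← h, neg_lt_zero]
  have hmap : (gaussianReal 0 1).map (fun x : ℝ ↦ -x) = gaussianReal 0 1 := by
    simpa using gaussianReal_map_neg (μ := 0) (v := 1)
  have hint' : Integrable (fun u ↦ k (-u)) (gaussianReal 0 1) := by
    rw [← hmap] at hint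
    exact (integrable_map_measure hint.aestronglyMeasurable (by fun_prop)).1 hint
  have hsym : ∫ u, k (-u) ∂(gaussianReal 0 1) = ∫ u, k u ∂(gaussianReal 0 1) := by
    conv_rhs => rw [← hmap]
    rw [integral_map (by fun_prop) (by rw [hmap]; exact hint.aestronglyMeasurable)]
  have hsum (u : ℝ) : k u + k (-u) =
      u ^ 2 * (4 * z.re * z.im / (((z.re - u) ^ 2 + z.im ^ 2) * ((z.re + u) ^ 2 + z.im ^ 2))) := by
    have h1 : 0 < (z.re - u) ^ 2 + z.im ^ 2 := by positivity
    have h2 : 0 < (z.re + u) ^ 2 + z.im ^ 2 := by positivity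
    simp only [hk, sub_neg_eq_add]
    field_simp
    ring
  have hpos : 0 < ∫ u, (k u + k (-u)) ∂(gaussianReal 0 1) := by
    have h0 (u : ℝ) : 0 ≤ k u + k (-u) := by rw [hsum]; positivity
    have hi : Integrable (fun u ↦ k u + k (-u)) (gaussianReal 0 1) := hint.add hint'
    rw [integral_pos_iff_support_of_nonneg h0 hi]
    have hsub : {(0 : ℝ)}ᶜ ⊆ Function.support fun u ↦ k u + k (-u) := by
      intro u hu
      have hu : u ≠ 0 := hu
      have : 0 < k u + k (-u) := by rw [hsum]; positivity
      exact this.ne'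
    refine lt_of_lt_of_le ?_ (measure_mono hsub)
    have : NullSingletonClass (gaussianReal 0 1) := nullSingletonClass_gaussianReal one_ne_zero
    rw [prob_compl_eq_one_sub (measurableSet_singleton _), measure_singleton]
    simp
  rw [integral_add hint hint', hsym] at hpos
  linarith

lemma mul_GTilde_im_neg_of_re_pos {z : ℂ} (hx : 0 < z.re) (hy : 0 ≤ z.im) :
    (z * GTilde z).im < 0 := by
  rcases hy.lt_or_eq with hy | hy
  · exact mul_GTilde_im_neg_of_pos hx hy
  · rw [mul_im, ← hy, zero_mul, add_zero]
    exact mul_neg_of_pos_of_neg hx (GTilde_im_neg_of_im_nonneg hy.le)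

/-! ### The transversality inequality on the boundary curve -/

/-- Where `G` is real in the part of `Xi` below the real axis, it exceeds `1 / Re z`. With
`a = π / (2x)`, the vanishing of `Im G` gives
`1 - x Re G = ∫ (s - a) cos (xs) e^{ys - s²/2} ds`. The integrand is nonpositive on `(0, a)`, and
translating by `a` turns the integral over `(a, ∞)` into a positive multiple of `Im (ζ G(ζ))` at the
point `ζ = x + i(a - y)` of the first quadrant. -/
lemma one_lt_re_mul_GTilde_re {z : ℂ} (hx : 0 < z.re) (hy : z.im < 0)
    (hxy : -(2 * z.re * z.im) < Real.pi) (h0 : (GTilde z).im = 0) :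
    1 < z.re * (GTilde z).re := by
  obtain ⟨x, y, rfl⟩ : ∃ x y : ℝ, z = ⟨x, -y⟩ := ⟨z.re, -z.im, by simp⟩
  simp only at hx hy hxy h0 ⊢
  set a := Real.pi / (2 * x) with ha
  have hxa : x * a = Real.pi / 2 := by rw [ha]; field_simp
  have hya : y < a := by
    rw [ha, lt_div_iff₀ (by positivity)]; linarith
  have ha0 : 0 < a := by rw [ha]; exact div_pos Real.pi_pos (by positivity)
  have h1 := one_sub_re_mul_re ⟨x, -y⟩
  have h2 := GTilde_im_eq_integral ⟨x, -y⟩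
  simp only [neg_neg, h0] at h1 h2
  have hi (b : ℝ) : Integrable fun s ↦ (s - b) * (Real.cos (x * s) * weight y s) := by
    simp only [sub_mul]
    exact (integrable_mul_cos_mul_weight x y).sub
      ((integrable_cos_mul_weight x y).const_mul b)
  have h3 : 1 - x * (GTilde ⟨x, -y⟩).re =
      ∫ s in Ioi (0 : ℝ), (s - a) * (Real.cos (x * s) * weight y s) := by
    have : ∀ s : ℝ, (s - a) * (Real.cos (x * s) * weight y s) =
        (s + -y) * (Real.cos (x * s) * weight y s) +
          (y - a) * (Real.cos (x * s) * weight y s) := fun s ↦ by ring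
    simp_rw [this]
    rw [integral_add (by simpa only [← sub_eq_add_neg] using! (hi y).integrableOn)
      ((integrable_cos_mul_weight x y).const_mul _).integrableOn, integral_const_mul, ← h1]
    linear_combination (-(y - a)) * h2
  have hsplit : ∫ s in Ioi (0 : ℝ), (s - a) * (Real.cos (x * s) * weight y s) =
      (∫ s in Ioc 0 a, (s - a) * (Real.cos (x * s) * weight y s)) +
        ∫ s in Ioi a, (s - a) * (Real.cos (x * s) * weight y s) := by
    rw [← setIntegral_union (Ioc_disjoint_Ioi le_rfl) measurableSet_Ioi (hi a).integrableOn
      (hi a).integrableOn, Ioc_union_Ioi_eq_Ioi ha0.le]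
  have hfirst : ∫ s in Ioc 0 a, (s - a) * (Real.cos (x * s) * weight y s) ≤ 0 := by
    refine setIntegral_nonpos measurableSet_Ioc fun s hs ↦ ?_
    have hcos : 0 ≤ Real.cos (x * s) := by
      refine Real.cos_nonneg_of_neg_pi_div_two_le_of_le ?_ ?_
      · have := mul_pos hx hs.1
        linarith [Real.pi_pos]
      · rw [← hxa]; exact mul_le_mul_of_nonneg_left hs.2 hx.le
    exact mul_nonpos_of_nonpos_of_nonneg (by linarith [hs.2])
      (mul_nonneg hcos (weight_pos y s).le)
  have hsecond : ∫ s in Ioi a, (s - a) * (Real.cos (x * s) * weight y s) =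
      -(weight y a * ∫ s in Ioi (0 : ℝ), s * (Real.sin (x * s) * weight (-(a - y)) s)) := by
    have hpre : (fun v : ℝ ↦ v + a) ⁻¹' Ioi a = Ioi 0 := by ext v; simp
    rw [← (measurePreserving_add_right volume a).setIntegral_preimage_emb
      (measurableEmbedding_addRight a), hpre, ← integral_const_mul, ← integral_neg]
    congr 1 with v
    have hc : Real.cos (x * (v + a)) = -Real.sin (x * v) := by
      rw [mul_add, hxa, Real.cos_add_pi_div_two]
    have hw : weight y (v + a) = weight y a * weight (-(a - y)) v := by
      simp only [weight, ← Real.exp_add]; congr 1; ring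
    rw [hc, hw]; ring
  have h4 := im_one_sub_mul_GTilde ⟨x, a - y⟩
  have h5 := mul_GTilde_im_neg_of_pos (z := ⟨x, a - y⟩) hx (by simpa using hya)
  rw [sub_im, one_im] at h4
  simp only at h4
  rw [← h4] at hsecond
  have h6 : 0 < weight y a * (0 - ((⟨x, a - y⟩ : ℂ) * GTilde ⟨x, a - y⟩).im) :=
    mul_pos (weight_pos _ _) (by linarith)
  linarith

/-! ### The sign of `Im G` on vertical lines -/

lemma GTilde_neg_conj_re (z : ℂ) : (GTilde (-conj z)).re = -(GTilde z).re := by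
  rw [GTilde_neg_conj]; simp

lemma GTilde_neg_conj_im (z : ℂ) : (GTilde (-conj z)).im = (GTilde z).im := by
  rw [GTilde_neg_conj]; simp

lemma neg_conj_mem_Xi {z : ℂ} : -conj z ∈ Xi ↔ z ∈ Xi := by
  simp [Xi]

lemma isOpen_Xi : IsOpen Xi := by
  have : Xi = {z | 0 < z.im} ∪ {z | |2 * z.re * z.im| < Real.pi} := by
    ext z
    simp only [Xi, mem_ofPred_eq, mem_union]
    constructor
    · rintro (h | h)
      · rcases h.lt_or_eq with h | h
        · exact Or.inl h
        · right; rw [← h]; simpa using Real.pi_pos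
      · exact Or.inr h
    · rintro (h | h)
      · exact Or.inl h.le
      · exact Or.inr h
  rw [this]
  exact (isOpen_lt continuous_const continuous_im).union
    (isOpen_lt (by fun_prop) continuous_const)

lemma neg_lt_pi_of_mem_Xi {z : ℂ} (hz : z ∈ Xi) (hy : z.im < 0) :
    -(2 * z.re * z.im) < Real.pi := by
  rcases hz with h | h
  · exact absurd h hy.not_ge
  · exact (neg_le_abs _).trans_lt h

lemma mem_Xi_of_neg_lt_pi {z : ℂ} (hx : 0 < z.re) (h : -(2 * z.re * z.im) < Real.pi) :
    z ∈ Xi := by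
  rcases le_or_gt 0 z.im with hy | hy
  · exact Or.inl hy
  · right
    rwa [abs_of_nonpos (mul_nonpos_of_nonneg_of_nonpos (by positivity) hy.le)]

/-- Moving up inside `Xi` along a vertical line. -/
lemma mem_Xi_of_im_le {z w : ℂ} (hz : z ∈ Xi) (hre : w.re = z.re) (him : z.im ≤ w.im) :
    w ∈ Xi := by
  rcases le_or_gt 0 w.im with hw | hw
  · exact Or.inl hw
  rcases hz with h | h
  · exact Or.inl (h.trans him)
  · right
    refine lt_of_le_of_lt ?_ h
    rw [abs_mul, abs_mul _ z.im, hre, abs_of_neg hw, abs_of_neg (him.trans_lt hw)]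
    gcongr

lemma GTilde_re_pos {z : ℂ} (hx : 0 < z.re) (hz : z ∈ Xi) : 0 < (GTilde z).re := by
  rcases le_or_gt 0 z.im with hy | hy
  · exact GTilde_re_pos_of_im_nonneg hx hy
  · have hpi := neg_lt_pi_of_mem_Xi hz hy
    have h1 : 0 < (GTilde (conj z)).re := GTilde_re_pos_of_im_nonneg (by simpa) (by simpa using hy.le)
    have h2 : Real.sin (z.re * z.im) < 0 :=
      Real.sin_neg_of_neg_of_neg_pi_lt (mul_neg_of_pos_of_neg hx hy) (by linarith [Real.pi_pos])
    rw [GTilde_re_reflect]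
    linarith [mul_neg_of_pos_of_neg (jump_pos z) h2]

/-- A function that crosses zero only upwards changes sign exactly once. -/
lemma exists_unique_sign_change {u u' : ℝ → ℝ} {a : ℝ} (ha : 0 < a)
    (hu : ∀ y, HasDerivAt u (u' y) y) (h0 : u 0 < 0) (h1 : 0 < u a)
    (hcross : ∀ y ∈ Ioo 0 a, u y = 0 → 0 < u' y) :
    ∃ c ∈ Ioo 0 a, u c = 0 ∧ (∀ y ∈ Ico 0 c, u y < 0) ∧ ∀ y ∈ Ioc c a, 0 < u y := by
  have hc : Continuous u := continuous_iff_continuousAt.2 fun y ↦ (hu y).continuousAt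
  have after : ∀ c ∈ Ioo 0 a, u c = 0 → ∀ y ∈ Ioc c a, 0 < u y := by
    intro c hca hc0
    have hnn : ∀ y ∈ Icc c a, -u y ≤ 0 := by
      intro y hy
      refine image_le_of_deriv_right_lt_deriv_boundary (f := fun y ↦ -u y) (f' := fun y ↦ -u' y)
        (B := fun _ ↦ 0) (B' := fun _ ↦ 0) hc.neg.continuousOn
        (fun y _ ↦ (hu y).neg.hasDerivWithinAt) (by simp [hc0]) (fun y ↦ hasDerivAt_const y 0)
        (fun y hy h ↦ ?_) hy
      exact neg_lt_zero.2 (hcross y ⟨hca.1.trans_le hy.1, hy.2⟩ (neg_eq_zero.1 h))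
    intro y hy
    refine lt_of_le_of_ne (neg_nonpos.1 (hnn y ⟨hy.1.le, hy.2⟩)) fun hy0 ↦ ?_
    have hya : y < a := lt_of_le_of_ne hy.2 fun h ↦ by rw [← h, ← hy0] at h1; exact h1.false
    have hpos := hcross y ⟨hca.1.trans hy.1, hya⟩ hy0.symm
    have hs := ((hasDerivAt_iff_tendsto_slope.1 (hu y)).mono_left
      (nhdsWithin_mono (s := Iio y) y fun z hz ↦ ne_of_lt hz)).eventually_const_lt hpos
    obtain ⟨t, ht, htI⟩ := (hs.and (Ioo_mem_nhdsLT hy.1)).exists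
    rw [slope_def_field, ← hy0, sub_zero] at ht
    have := hnn t ⟨htI.1.le, (htI.2.trans hya).le⟩
    have hneg : u t / (t - y) ≤ 0 :=
      div_nonpos_of_nonneg_of_nonpos (by linarith) (by linarith [htI.2])
    exact absurd ht hneg.not_gt
  obtain ⟨c, hcI, hc0⟩ := intermediate_value_Ioo ha.le hc.continuousOn (mem_Ioo.2 ⟨h0, h1⟩)
  refine ⟨c, hcI, hc0, fun y hy ↦ ?_, after c hcI hc0⟩
  by_contra hcon
  push Not at hcon
  obtain ⟨d, hd, hd0⟩ := intermediate_value_Ioc hy.1 hc.continuousOn (mem_Ioc.2 ⟨h0, hcon⟩)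
  have := after d ⟨hd.1, hd.2.trans_lt (hy.2.trans hcI.2)⟩ hd0 c ⟨hd.2.trans_lt hy.2, hcI.2.le⟩
  exact this.ne' hc0

lemma hasDerivAt_GTilde_im_vertical (x y : ℝ) :
    HasDerivAt (fun y : ℝ ↦ (GTilde ⟨x, y⟩).im) (1 - ⟨x, y⟩ * GTilde ⟨x, y⟩ : ℂ).re y := by
  have h0 : HasDerivAt (fun y : ℝ ↦ (⟨x, y⟩ : ℂ)) I y := by
    have h : HasDerivAt (fun y : ℝ ↦ (x : ℂ) + y * I) I y := by
      simpa using ((ofRealCLM.hasDerivAt (x := y)).mul_const I).const_add (x : ℂ)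
    refine h.congr_of_eventuallyEq (Eventually.of_forall fun y ↦ ?_)
    apply Complex.ext <;> simp
  have h1 := (hasDerivAt_GTilde ⟨x, y⟩).scomp y h0
  have h2 := imCLM.hasFDerivAt.comp_hasDerivAt y h1
  simpa [Function.comp_def] using h2

lemma GTilde_im_pos_of_eq_pi {z : ℂ} (hy : z.im < 0) (h : |2 * z.re * z.im| = Real.pi) :
    0 < (GTilde z).im := by
  have hcos : Real.cos (z.re * z.im) = 0 := by
    rw [← Real.cos_abs, show |z.re * z.im| = Real.pi / 2 from ?_, Real.cos_pi_div_two]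
    rw [mul_assoc, abs_mul, abs_two] at h
    linarith
  have := GTilde_im_neg_of_im_pos (z := conj z) (by simpa)
  rw [GTilde_im_reflect, hcos]
  linarith

/-- On each vertical line `Re z = x > 0`, inside `Xi`, the sign of `Im G` changes exactly once: it is
negative on the real axis, positive on the curve bounding `Xi`, and by `one_lt_re_mul_GTilde_re` its
zeros are crossed in one direction only. -/
lemma exists_sign_change_height {x : ℝ} (hx : 0 < x) :
    ∃ c : ℝ, c < 0 ∧ (⟨x, c⟩ : ℂ) ∈ Xi ∧ (GTilde ⟨x, c⟩).im = 0 ∧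
      (∀ y, c < y → (GTilde ⟨x, y⟩).im < 0) ∧
      ∀ y, (⟨x, y⟩ : ℂ) ∈ Xi → y < c → 0 < (GTilde ⟨x, y⟩).im := by
  have ha : 0 < Real.pi / (2 * x) := div_pos Real.pi_pos (by positivity)
  obtain ⟨c, hc, hc0, hlt, hgt⟩ := exists_unique_sign_change
    (u := fun y ↦ (GTilde ⟨x, -y⟩).im)
    (u' := fun y ↦ (1 - ⟨x, -y⟩ * GTilde ⟨x, -y⟩ : ℂ).re * -1) ha
    (fun y ↦ (hasDerivAt_GTilde_im_vertical x (-y)).comp y (hasDerivAt_neg y))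
    (GTilde_im_neg_of_im_nonneg (by simp))
    (GTilde_im_pos_of_eq_pi (by simpa using ha) (by
      simp only [mul_neg, abs_neg]
      rw [mul_div_cancel₀ _ (by positivity), abs_of_pos Real.pi_pos]))
    (fun y hy h0 ↦ by
      have h := one_lt_re_mul_GTilde_re (z := ⟨x, -y⟩) hx (by simpa using hy.1)
        (by have := (lt_div_iff₀' (by positivity)).1 hy.2; simpa using this) h0
      simp only [sub_re, one_re, mul_re, h0] at h ⊢
      linarith)
  have hmem : (⟨x, -c⟩ : ℂ) ∈ Xi := mem_Xi_of_neg_lt_pi hx (by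
    have := (lt_div_iff₀' (by positivity)).1 hc.2; simpa using this)
  refine ⟨-c, by simpa using hc.1, hmem, hc0, fun y hy ↦ ?_, fun y hyX hy ↦ ?_⟩
  · rcases le_or_gt 0 y with h | h
    · exact GTilde_im_neg_of_im_nonneg h
    · simpa using hlt (-y) ⟨by linarith, by linarith⟩
  · have hneg : y < 0 := by linarith [hc.1]
    have := neg_lt_pi_of_mem_Xi hyX hneg
    simp only at this
    have h := hgt (-y) ⟨by linarith, (le_div_iff₀' (by positivity)).2 (by linarith)⟩
    simpa using h

/-- The derivative `1 - z G(z)` of `G` does not vanish where `z ∈ Xi` and `Im G(z) ≤ 0`. -/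
lemma one_sub_mul_GTilde_ne_zero {z : ℂ} (hz : z ∈ Xi) (hG : (GTilde z).im ≤ 0) :
    1 - z * GTilde z ≠ 0 := by
  have key {w : ℂ} (hx : 0 < w.re) (hw : w ∈ Xi) (hG : (GTilde w).im ≤ 0) :
      (w * GTilde w).im < 0 := by
    rcases le_or_gt 0 w.im with hy | hy
    · exact mul_GTilde_im_neg_of_re_pos hx hy
    · rw [mul_im]
      have := mul_neg_of_neg_of_pos hy (GTilde_re_pos hx hw)
      have := mul_nonpos_of_nonneg_of_nonpos hx.le hG
      linarith
  intro h
  rcases lt_trichotomy z.re 0 with hx | hx | hx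
  · have := key (w := -conj z) (by simpa) (neg_conj_mem_Xi.2 hz) (by rwa [GTilde_neg_conj_im])
    rw [GTilde_neg_conj, neg_mul_neg, ← map_mul, ← sub_eq_zero.1 h] at this
    simp at this
  · have := one_sub_mul_GTilde_re_pos_of_re_eq_zero hx
    rw [h] at this
    simp at this
  · have := key hx hz hG
    rw [← sub_eq_zero.1 h] at this
    simp at this

/-! ### The region `Xi ∩ {Im G ≤ 0}` -/

/-- The part of `Xi` where `Im G < 0`. It turns out to be `Omega`. -/
def openRegion : Set ℂ := {z | z ∈ Xi ∧ (GTilde z).im < 0}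

/-- The part of `Xi` where `Im G ≤ 0`. It turns out to be the closure of `Omega`. -/
def closedRegion : Set ℂ := {z | z ∈ Xi ∧ (GTilde z).im ≤ 0}

lemma openRegion_subset : openRegion ⊆ closedRegion := fun _ hz ↦ ⟨hz.1, hz.2.le⟩

lemma isOpen_openRegion : IsOpen openRegion :=
  isOpen_Xi.inter (isOpen_lt (continuous_im.comp continuous_GTilde) continuous_const)

/-- Closed although `Xi` is open, since `Im G > 0` on the curves bounding `Xi`. -/
lemma isClosed_closedRegion : IsClosed closedRegion := by
  have : closedRegion = ({z | 0 ≤ z.im} ∪ {z | |2 * z.re * z.im| ≤ Real.pi}) ∩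
      {z | (GTilde z).im ≤ 0} := by
    ext z
    refine ⟨fun hz ↦ ⟨hz.1.imp id le_of_lt, hz.2⟩, fun hz ↦ ⟨?_, hz.2⟩⟩
    rcases le_or_gt 0 z.im with hy | hy
    · exact Or.inl hy
    · refine Or.inr (lt_of_le_of_ne (hz.1.resolve_left hy.not_ge) fun h ↦ ?_)
      exact (GTilde_im_pos_of_eq_pi hy h).not_ge hz.2
  rw [this]
  exact ((isClosed_le continuous_const continuous_im).union
    (isClosed_le (by fun_prop) continuous_const)).inter (isClosed_le (by fun_prop) continuous_const)

lemma openRegion_of_re_eq_zero {z : ℂ} (hz : z.re = 0) : z ∈ openRegion :=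
  ⟨Or.inr (by simpa [hz] using Real.pi_pos), GTilde_im_neg_of_re_eq_zero hz⟩

lemma neg_conj_mem_closedRegion {z : ℂ} : -conj z ∈ closedRegion ↔ z ∈ closedRegion := by
  simp only [closedRegion, mem_ofPred_eq, neg_conj_mem_Xi, GTilde_neg_conj_im]

lemma neg_conj_mem_openRegion {z : ℂ} : -conj z ∈ openRegion ↔ z ∈ openRegion := by
  simp only [openRegion, mem_ofPred_eq, neg_conj_mem_Xi, GTilde_neg_conj_im]

lemma openRegion_of_lt_im {z w : ℂ} (hz : z ∈ closedRegion) (hre : w.re = z.re)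
    (him : z.im < w.im) : w ∈ openRegion := by
  have key {z w : ℂ} (hx : 0 < z.re) (hz : z ∈ closedRegion) (hre : w.re = z.re)
      (him : z.im < w.im) : w ∈ openRegion := by
    obtain ⟨c, -, -, -, hlt, hgt⟩ := exists_sign_change_height hx
    have hcz : c ≤ z.im := le_of_not_gt fun h ↦ (hgt z.im hz.1 h).not_ge hz.2
    have := hlt w.im (hcz.trans_lt him)
    rw [← hre] at this
    exact ⟨mem_Xi_of_im_le hz.1 hre him.le, this⟩
  rcases lt_trichotomy z.re 0 with hx | hx | hx
  · exact neg_conj_mem_openRegion.1 (key (z := -conj z) (by simpa)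
      (neg_conj_mem_closedRegion.2 hz) (by simpa) (by simpa))
  · exact openRegion_of_re_eq_zero (hre.trans hx)
  · exact key hx hz hre him

lemma closure_openRegion : closure openRegion = closedRegion := by
  refine (isClosed_closedRegion.closure_subset_iff.2 openRegion_subset).antisymm fun z hz ↦ ?_
  have ht : Tendsto (fun t : ℝ ↦ z + t * I) (𝓝[>] 0) (𝓝 z) := by
    have : Continuous fun t : ℝ ↦ z + t * I := by fun_prop
    simpa using (this.tendsto 0).mono_left nhdsWithin_le_nhds
  refine mem_closure_of_tendsto ht (eventually_mem_nhdsWithin.mono fun t (ht : 0 < t) ↦ ?_)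
  exact openRegion_of_lt_im hz (by simp) (by simpa)

lemma upperHalf_subset_openRegion : upperHalf ⊆ openRegion :=
  fun _ (hz : 0 < _) ↦ ⟨Or.inl hz.le, GTilde_im_neg_of_im_pos hz⟩

/-- Every point of the region is joined by a vertical segment to the upper half-plane. -/
lemma isConnected_openRegion : IsConnected openRegion := by
  have hI : I ∈ openRegion := openRegion_of_re_eq_zero I_re
  refine ⟨⟨I, hI⟩, isPreconnected_of_forall I fun z hz ↦ ?_⟩
  have hU : IsPreconnected upperHalf := (convex_halfSpace_im_gt 0).isPreconnected
  have hV : IsPreconnected {w : ℂ | w.re = z.re ∧ z.im ≤ w.im} :=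
    ((convex_hyperplane reLm.isLinear z.re).inter (convex_halfSpace_im_ge z.im)).isPreconnected
  refine ⟨upperHalf ∪ {w | w.re = z.re ∧ z.im ≤ w.im}, ?_, Or.inl (by simp [upperHalf]),
    Or.inr ⟨rfl, le_rfl⟩, hU.union (⟨z.re, max z.im 1⟩ : ℂ) (by simp [upperHalf])
      ⟨rfl, le_max_left _ _⟩ hV⟩
  rintro w (hw | ⟨hre, him⟩)
  · exact upperHalf_subset_openRegion hw
  · rcases him.lt_or_eq with h | h
    · exact openRegion_of_lt_im (openRegion_subset hz) hre h
    · rwa [Complex.ext (z := w) (w := z) hre h.symm]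

/-! ### Properness -/

lemma norm_mul_GTilde_le {z : ℂ} (hz : 0 ≤ z.im) : ‖z * GTilde z‖ ≤ 2 := by
  have h1 : ∫ s in Ioi (0 : ℝ), s * weight 0 s = 1 := by
    simpa using (re_one_sub_mul_GTilde 0).symm
  have h2 : ‖1 - z * GTilde z‖ ≤ 1 := by
    rw [one_sub_mul_GTilde, ← h1]
    refine norm_integral_le_of_norm_le (integrable_mul_weight 0).integrableOn
      ((ae_restrict_mem measurableSet_Ioi).mono fun s (hs : 0 < s) ↦ ?_)
    rw [norm_mul, norm_kernel, norm_real, Real.norm_of_nonneg hs.le]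
    unfold weight
    gcongr
    simpa using hz
  calc ‖z * GTilde z‖ = ‖1 - (1 - z * GTilde z)‖ := by congr 1; ring
    _ ≤ ‖(1 : ℂ)‖ + ‖1 - z * GTilde z‖ := norm_sub_le _ _
    _ ≤ 2 := by rw [norm_one]; linarith

lemma norm_sub_conj_GTilde (z : ℂ) : ‖conj (GTilde (conj z)) - GTilde z‖ = jump z := by
  have h : conj (GTilde (conj z)) - GTilde z =
      2 * I * (Real.sqrt (Real.pi / 2) : ℂ) * cexp (-z ^ 2 / 2) := by
    linear_combination -GTilde_eq_conj_sub z
  rw [h, jump, norm_mul, norm_mul, norm_mul, norm_I, Complex.norm_exp,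
    (neg_sq_div_two_re_im z).1, norm_real, Real.norm_of_nonneg (Real.sqrt_nonneg _)]
  simp

/-- In `Xi`, at infinity, `G` tends to `0` or to `∞`: it is `O(1/|z|)` above the real axis, and below
it the reflection formula adds a term of modulus `√(2π) e^{(y² - x²)/2}` where one of `|x|`, `|y|`
is bounded. -/
lemma exists_norm_le_of_norm_GTilde {c : ℝ} (hc : 0 < c) (C : ℝ) :
    ∃ R, ∀ z ∈ Xi, c ≤ ‖GTilde z‖ → ‖GTilde z‖ ≤ C → ‖z‖ ≤ R := by
  set A := 2 * Real.sqrt (Real.pi / 2) with hA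
  have hA0 : 0 < A := by have := Real.pi_pos; positivity
  have hsq : Tendsto (fun r : ℝ ↦ (r ^ 2 - Real.pi) / 2) atTop atTop :=
    (tendsto_atTop_add_const_right _ (-Real.pi)
      (tendsto_pow_atTop two_ne_zero)).atTop_div_const two_pos
  have hsmall : ∀ᶠ r : ℝ in atTop, A * Real.exp (-((r ^ 2 - Real.pi) / 2)) < c / 2 := by
    have := (Real.tendsto_exp_neg_atTop_nhds_zero.comp hsq).const_mul A
    rw [mul_zero] at this
    exact this.eventually_lt_const (by positivity)
  have hlarge : ∀ᶠ r : ℝ in atTop, C + c / 2 < A * Real.exp ((r ^ 2 - Real.pi) / 2) :=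
    ((Real.tendsto_exp_atTop.comp hsq).const_mul_atTop hA0).eventually_gt_atTop _
  obtain ⟨R, hR⟩ := eventually_atTop.1 (hsmall.and (hlarge.and (eventually_gt_atTop (4 / c))))
  refine ⟨R, fun z hz h1 h2 ↦ le_of_not_gt fun hlt ↦ ?_⟩
  obtain ⟨hs, hl, h4⟩ := hR ‖z‖ hlt.le
  have hz0 : 0 < ‖z‖ := lt_trans (by positivity) h4
  have hup {w : ℂ} (hw : 0 ≤ w.im) (hn : ‖w‖ = ‖z‖) : ‖GTilde w‖ < c / 2 := by
    have := norm_mul_GTilde_le hw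
    rw [norm_mul, hn] at this
    rw [div_lt_iff₀ hc] at h4
    nlinarith
  rcases le_or_gt 0 z.im with hy | hy
  · linarith [hup hy rfl]
  · have hu := hup (w := conj z) (by simpa using hy.le) (by simp)
    have hj := norm_sub_conj_GTilde z
    have hj1 : jump z ≤ ‖GTilde (conj z)‖ + ‖GTilde z‖ := by
      rw [← hj, ← RCLike.norm_conj (GTilde (conj z))]; exact norm_sub_le _ _
    have hj2 : ‖GTilde z‖ ≤ ‖GTilde (conj z)‖ + jump z := by
      have h := norm_sub_le (conj (GTilde (conj z))) (conj (GTilde (conj z)) - GTilde z)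
      rwa [sub_sub_cancel, hj, RCLike.norm_conj] at h
    have hpi : |2 * z.re * z.im| < Real.pi := hz.resolve_left hy.not_ge
    have hns : ‖z‖ ^ 2 = z.re ^ 2 + z.im ^ 2 := by
      rw [← normSq_eq_norm_sq, normSq_apply]; ring
    rw [mul_assoc, abs_mul, abs_two, abs_mul] at hpi
    rw [jump, ← hA] at hj1 hj2
    rcases le_total |z.im| |z.re| with h | h
    · have h5 : z.im ^ 2 ≤ |z.re| * |z.im| := by
        rw [← sq_abs, pow_two]; gcongr
      have h6 : A * Real.exp ((z.im ^ 2 - z.re ^ 2) / 2) ≤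
          A * Real.exp (-((‖z‖ ^ 2 - Real.pi) / 2)) := by
        gcongr; rw [hns]; linarith
      linarith
    · have h5 : z.re ^ 2 ≤ |z.re| * |z.im| := by
        rw [← sq_abs, pow_two]; gcongr
      have h6 : A * Real.exp ((‖z‖ ^ 2 - Real.pi) / 2) ≤
          A * Real.exp ((z.im ^ 2 - z.re ^ 2) / 2) := by
        gcongr A * Real.exp (?_ / 2)
        rw [hns]; linarith
      linarith

lemma isCompact_closedRegion_annulus {c : ℝ} (hc : 0 < c) (C : ℝ) :
    IsCompact (closedRegion ∩ {z | c ≤ ‖GTilde z‖ ∧ ‖GTilde z‖ ≤ C}) := by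
  obtain ⟨R, hR⟩ := exists_norm_le_of_norm_GTilde hc C
  refine Metric.isCompact_of_isClosed_isBounded
    (isClosed_closedRegion.inter ((isClosed_le continuous_const continuous_GTilde.norm).and
      (isClosed_le continuous_GTilde.norm continuous_const)))
    (isBounded_iff_forall_norm_le.2 ⟨R, fun z hz ↦ hR z hz.1.1 hz.2.1 hz.2.2⟩)

/-! ### Bijectivity of the transform -/

lemma hasStrictDerivAt_GTilde (z : ℂ) : HasStrictDerivAt GTilde (1 - z * GTilde z) z := by
  have h := (differentiable_GTilde.analyticAt z).hasStrictDerivAt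
  rwa [(hasDerivAt_GTilde z).deriv] at h

lemma map_nhds_GTilde {z : ℂ} (hz : z ∈ closedRegion) : map GTilde (𝓝 z) = 𝓝 (GTilde z) :=
  (hasStrictDerivAt_GTilde z).map_nhds_eq (one_sub_mul_GTilde_ne_zero hz.1 hz.2)

lemma exists_mem_nhds_injOn_GTilde {z : ℂ} (hz : z ∈ closedRegion) :
    ∃ N, IsOpen N ∧ z ∈ N ∧ InjOn GTilde N := by
  have h := (hasStrictDerivAt_GTilde z).eventually_left_inverse
    (one_sub_mul_GTilde_ne_zero hz.1 hz.2)
  obtain ⟨N, hN, hNo, hzN⟩ := eventually_nhds_iff.1 h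
  exact ⟨N, hNo, hzN, LeftInvOn.injOn fun x hx ↦ hN x hx⟩

lemma GTilde_ne_zero {z : ℂ} (hz : z ∈ Xi) : GTilde z ≠ 0 := by
  intro h
  rcases lt_trichotomy z.re 0 with hx | hx | hx
  · have := GTilde_re_pos (z := -conj z) (by simpa) (neg_conj_mem_Xi.2 hz)
    rw [GTilde_neg_conj_re, h] at this
    simp at this
  · have := GTilde_im_neg_of_re_eq_zero hx
    rw [h] at this
    simp at this
  · have := GTilde_re_pos hx hz
    rw [h] at this
    simp at this

/-- Near a nonzero value `w`, all preimages in `closedRegion` stay in a compact set. -/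
lemma exists_isCompact_preimages {w : ℂ} (hw : w ≠ 0) :
    ∃ M, IsCompact M ∧ M ⊆ closedRegion ∧
      ∀ᶠ w' in 𝓝 w, ∀ z ∈ closedRegion, GTilde z = w' → z ∈ M := by
  have hn : 0 < ‖w‖ := norm_pos_iff.2 hw
  refine ⟨_, isCompact_closedRegion_annulus (half_pos hn) (2 * ‖w‖), inter_subset_left, ?_⟩
  have h1 : ∀ᶠ w' in 𝓝 w, ‖w‖ / 2 < ‖w'‖ :=
    continuous_norm.continuousAt.eventually_const_lt (half_lt_self hn)
  have h2 : ∀ᶠ w' in 𝓝 w, ‖w'‖ < 2 * ‖w‖ :=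
    continuous_norm.continuousAt.eventually_lt_const (by linarith)
  filter_upwards [h1, h2] with w' h1 h2 z hz hzw
  exact ⟨hz, by rw [hzw]; exact h1.le, by rw [hzw]; exact h2.le⟩

/-- By properness, the image of the closed region is closed in `ℂ ∖ {0}`. -/
lemma mem_image_of_mem_closure {w : ℂ} (hw : w ≠ 0) (hcl : w ∈ closure (GTilde '' closedRegion)) :
    w ∈ GTilde '' closedRegion := by
  obtain ⟨M, hM, hMs, hev⟩ := exists_isCompact_preimages hw
  have hcM : IsClosed (GTilde '' M) := (hM.image continuous_GTilde).isClosed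
  refine image_mono hMs (hcM.mem_of_frequently_of_tendsto ?_ tendsto_id)
  refine ((mem_closure_iff_frequently.1 hcl).and_eventually hev).mono ?_
  rintro _ ⟨⟨z, hz, rfl⟩, h⟩
  exact mem_image_of_mem _ (h z hz rfl)

/-- The image is open by the open mapping theorem and relatively closed in the half-plane by
properness. -/
lemma surjOn_GTilde_openRegion : {w : ℂ | w.im < 0} ⊆ GTilde '' openRegion := by
  have hconn : IsPreconnected {w : ℂ | w.im < 0} := (convex_halfSpace_im_lt 0).isPreconnected
  refine hconn.subset_of_closure_inter_subset ?_ ?_ ?_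
  · rw [isOpen_iff_mem_nhds]
    rintro _ ⟨z, hz, rfl⟩
    rw [← map_nhds_GTilde (openRegion_subset hz)]
    exact image_mem_map (isOpen_openRegion.mem_nhds hz)
  · have h0 : (0 : ℂ) ∈ openRegion := openRegion_of_re_eq_zero rfl
    exact ⟨GTilde 0, h0.2, mem_image_of_mem _ h0⟩
  · rintro w ⟨hcl, hw : w.im < 0⟩
    obtain ⟨z, hz, rfl⟩ := mem_image_of_mem_closure (fun h ↦ by simp [h] at hw)
      (closure_mono (image_mono openRegion_subset) hcl)
    exact ⟨z, ⟨hz.1, hw⟩, rfl⟩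

/-- The value `G(0)` is attained only at `0`: `G` is purely imaginary on the imaginary axis only, and
there it is strictly monotone. -/
lemma eq_zero_of_GTilde_eq {z : ℂ} (hz : z ∈ openRegion) (h : GTilde z = GTilde 0) : z = 0 := by
  have h0 : (GTilde 0).re = 0 := GTilde_re_of_re_eq_zero rfl
  have hre : z.re = 0 := by
    rcases lt_trichotomy z.re 0 with hx | hx | hx
    · have := GTilde_re_pos (z := -conj z) (by simpa) (neg_conj_mem_Xi.2 hz.1)
      rw [GTilde_neg_conj_re, h, h0] at this
      simp at this
    · exact hx
    · have := GTilde_re_pos hx hz.1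
      rw [h, h0] at this
      simp at this
  have hmono : StrictMono fun y : ℝ ↦ (GTilde ⟨0, y⟩).im := by
    refine strictMono_of_deriv_pos fun y ↦ ?_
    rw [(hasDerivAt_GTilde_im_vertical 0 y).deriv]
    exact one_sub_mul_GTilde_re_pos_of_re_eq_zero rfl
  have hz' : z = ⟨0, z.im⟩ := Complex.ext hre rfl
  refine Complex.ext hre (hmono.injective (a₂ := 0) ?_)
  show (GTilde ⟨0, z.im⟩).im = (GTilde 0).im
  rw [← hz', h]

/-- The values attained twice form an open set by the open mapping theorem. Those attained exactly
once form an open set as well: near the unique preimage `G` is injective, and by properness all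
preimages of nearby values are near it. Connectedness of the half-plane concludes. -/
lemma injOn_GTilde_openRegion : InjOn GTilde openRegion := by
  set U : Set ℂ := {w | ∃ z₁ ∈ openRegion, ∃ z₂ ∈ openRegion, z₁ ≠ z₂ ∧
    GTilde z₁ = w ∧ GTilde z₂ = w} with hU
  have hUo : IsOpen U := by
    rw [isOpen_iff_mem_nhds]
    rintro w ⟨z₁, h₁, z₂, h₂, hne, hw₁, hw₂⟩
    obtain ⟨N₁, N₂, hN₁, hN₂, hz₁, hz₂, hd⟩ := t2_separation hne
    have m₁ : GTilde '' (N₁ ∩ openRegion) ∈ 𝓝 w := by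
      rw [← hw₁, ← map_nhds_GTilde (openRegion_subset h₁)]
      exact image_mem_map ((hN₁.inter isOpen_openRegion).mem_nhds ⟨hz₁, h₁⟩)
    have m₂ : GTilde '' (N₂ ∩ openRegion) ∈ 𝓝 w := by
      rw [← hw₂, ← map_nhds_GTilde (openRegion_subset h₂)]
      exact image_mem_map ((hN₂.inter isOpen_openRegion).mem_nhds ⟨hz₂, h₂⟩)
    filter_upwards [m₁, m₂]
    rintro w' ⟨a, ha, rfl⟩ ⟨b, hb, hab⟩
    exact ⟨a, ha.2, b, hb.2, fun h ↦ disjoint_left.1 hd ha.1 (h ▸ hb.1), rfl, hab⟩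
  have hconn : IsPreconnected {w : ℂ | w.im < 0} := (convex_halfSpace_im_lt 0).isPreconnected
  have hlow : IsOpen {w : ℂ | w.im < 0} := isOpen_lt continuous_im continuous_const
  have hsub : {w : ℂ | w.im < 0} ⊆ {w : ℂ | w.im < 0} \ U := by
    refine hconn.subset_of_closure_inter_subset ?_ ?_ ?_
    · rw [isOpen_iff_mem_nhds]
      rintro w ⟨hw, hwU⟩
      obtain ⟨z, hz, hzw⟩ := surjOn_GTilde_openRegion hw
      have hw0 : w ≠ 0 := by rw [← hzw]; exact GTilde_ne_zero hz.1
      obtain ⟨N, hNo, hzN, hNinj⟩ := exists_mem_nhds_injOn_GTilde (openRegion_subset hz)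
      obtain ⟨M, hM, hMs, hev⟩ := exists_isCompact_preimages hw0
      have hcl : IsClosed (GTilde '' (M \ N)) := ((hM.diff hNo).image continuous_GTilde).isClosed
      have hwn : w ∉ GTilde '' (M \ N) := by
        rintro ⟨a, ha, haw⟩
        have haz : a ≠ z := fun h ↦ ha.2 (h ▸ hzN)
        refine hwU ⟨a, ⟨(hMs ha.1).1, ?_⟩, z, hz, haz, haw, hzw⟩
        rw [haw]; exact hw
      filter_upwards [hev, hcl.isOpen_compl.mem_nhds hwn, hlow.mem_nhds hw] with w' h1 h2 h3
      refine ⟨h3, ?_⟩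
      rintro ⟨a, ha, b, hb, hab, haw, hbw⟩
      have hmem {c : ℂ} (hc : c ∈ openRegion) (hcw : GTilde c = w') : c ∈ N := by
        by_contra hcN
        exact h2 ⟨c, ⟨h1 c (openRegion_subset hc) hcw, hcN⟩, hcw⟩
      exact hab (hNinj (hmem ha haw) (hmem hb hbw) (haw.trans hbw.symm))
    · have h0 : (0 : ℂ) ∈ openRegion := openRegion_of_re_eq_zero rfl
      refine ⟨GTilde 0, h0.2, h0.2, ?_⟩
      rintro ⟨a, ha, b, hb, hab, haw, hbw⟩
      exact hab ((eq_zero_of_GTilde_eq ha haw).trans (eq_zero_of_GTilde_eq hb hbw).symm)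
    · rintro w ⟨hcl, hw⟩
      refine ⟨hw, fun hwU ↦ ?_⟩
      obtain ⟨w', h1, h2⟩ := mem_closure_iff.1 hcl U hUo hwU
      exact h2.2 h1
  intro a ha b hb hab
  by_contra hne
  exact (hsub (a := GTilde a) ha.2).2 ⟨a, ha, b, hb, hne, rfl, hab.symm⟩

/-- Two preimages of a boundary value would give two preimages of nearby interior values. -/
lemma injOn_GTilde_closedRegion : InjOn GTilde closedRegion := by
  intro a ha b hb hab
  by_contra hne
  obtain ⟨N₁, N₂, hN₁, hN₂, h₁, h₂, hd⟩ := t2_separation hne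
  have m₁ : GTilde '' (N₁ ∩ Xi) ∈ 𝓝 (GTilde a) := by
    rw [← map_nhds_GTilde ha]
    exact image_mem_map ((hN₁.inter isOpen_Xi).mem_nhds ⟨h₁, ha.1⟩)
  have m₂ : GTilde '' (N₂ ∩ Xi) ∈ 𝓝 (GTilde a) := by
    rw [hab, ← map_nhds_GTilde hb]
    exact image_mem_map ((hN₂.inter isOpen_Xi).mem_nhds ⟨h₂, hb.1⟩)
  have hcl : GTilde a ∈ closure {w : ℂ | w.im < 0} := by
    rw [closure_setOfPred_im_lt]; exact ha.2
  obtain ⟨w, ⟨⟨c, hc, hcw⟩, ⟨d, hd', hdw⟩⟩, hw⟩ :=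
    mem_closure_iff_nhds.1 hcl _ (inter_mem m₁ m₂)
  have hw : w.im < 0 := hw
  have hcd := injOn_GTilde_openRegion (x₁ := c) (x₂ := d) ⟨hc.2, by rwa [hcw]⟩
    ⟨hd'.2, by rwa [hdw]⟩ (hcw.trans hdw.symm)
  exact disjoint_left.1 hd hc.1 (hcd ▸ hd'.1)

lemma surjOn_GTilde_closedRegion {w : ℂ} (hw : w ≠ 0) (him : w.im ≤ 0) :
    w ∈ GTilde '' closedRegion := by
  refine mem_image_of_mem_closure hw (closure_mono
    (surjOn_GTilde_openRegion.trans (image_mono openRegion_subset)) ?_)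
  rw [closure_setOfPred_im_lt]; exact him

/-! ### The reciprocal -/

lemma FTilde_eq_inv (z : ℂ) : FTilde z = (GTilde z)⁻¹ := one_div _

lemma GTilde_eq_inv (z : ℂ) : GTilde z = (FTilde z)⁻¹ := by rw [FTilde_eq_inv, inv_inv]

lemma inv_im_pos_iff {w : ℂ} : 0 < (w⁻¹).im ↔ w.im < 0 := by
  rcases eq_or_ne w 0 with rfl | hw
  · simp
  · rw [inv_im, div_pos_iff_of_pos_right (normSq_pos.2 hw), neg_pos]

lemma inv_im_nonneg_iff {w : ℂ} : 0 ≤ (w⁻¹).im ↔ w.im ≤ 0 := by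
  rcases eq_or_ne w 0 with rfl | hw
  · simp
  · rw [inv_im, le_div_iff₀ (normSq_pos.2 hw), zero_mul, neg_nonneg]

lemma injOn_FTilde_closedRegion : InjOn FTilde closedRegion := fun a ha b hb hab ↦
  injOn_GTilde_closedRegion ha hb (by rw [GTilde_eq_inv, hab, ← GTilde_eq_inv])

lemma bijOn_FTilde_openRegion : BijOn FTilde openRegion upperHalf := by
  refine ⟨fun z hz ↦ ?_, injOn_FTilde_closedRegion.mono openRegion_subset, fun w hw ↦ ?_⟩
  · show 0 < (FTilde z).im
    rw [FTilde_eq_inv, inv_im_pos_iff]; exact hz.2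
  · have hw : 0 < w.im := hw
    obtain ⟨z, hz, hzw⟩ := surjOn_GTilde_openRegion (a := w⁻¹)
      (show (w⁻¹).im < 0 by rwa [← inv_im_pos_iff, inv_inv])
    exact ⟨z, hz, by rw [FTilde_eq_inv, hzw, inv_inv]⟩

lemma bijOn_FTilde_closedRegion : BijOn FTilde closedRegion {w : ℂ | 0 ≤ w.im ∧ w ≠ 0} := by
  refine ⟨fun z hz ↦ ?_, injOn_FTilde_closedRegion, ?_⟩
  · show 0 ≤ (FTilde z).im ∧ FTilde z ≠ 0
    rw [FTilde_eq_inv, inv_im_nonneg_iff]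
    exact ⟨hz.2, inv_ne_zero (GTilde_ne_zero hz.1)⟩
  · rintro w ⟨hw, hw0⟩
    obtain ⟨z, hz, hzw⟩ := surjOn_GTilde_closedRegion (inv_ne_zero hw0)
      (by rwa [← inv_im_nonneg_iff, inv_inv])
    exact ⟨z, hz, by rw [FTilde_eq_inv, hzw, inv_inv]⟩

lemma analyticAt_FTilde {z : ℂ} (hz : z ∈ Xi) : AnalyticAt ℂ FTilde z :=
  analyticAt_const.div (differentiable_GTilde.analyticAt z) (GTilde_ne_zero hz)

/-- `F` is a homeomorphism of the closed region, being a continuous proper bijection. -/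
lemma exists_homeomorph_closedRegion :
    ∃ e : closedRegion ≃ₜ {w : ℂ | 0 ≤ w.im ∧ w ≠ 0},
      ∀ z : closedRegion, (e z : ℂ) = FTilde (z : ℂ) := by
  set T : Set ℂ := {w : ℂ | 0 ≤ w.im ∧ w ≠ 0} with hT
  have hlc : IsLocallyClosed T :=
    (isClosed_le continuous_const continuous_im).isLocallyClosed.inter
      isOpen_ne.isLocallyClosed
  have : LocallyCompactSpace T := hlc.locallyCompactSpace
  let e : closedRegion ≃ T := bijOn_FTilde_closedRegion.equiv FTilde
  have he (z : closedRegion) : (e z : ℂ) = FTilde z := rfl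
  have hcont : Continuous e := by
    refine Continuous.subtype_mk (continuous_iff_continuousAt.2 fun z ↦ ?_) _
    exact (analyticAt_FTilde z.2.1).continuousAt.comp continuous_subtype_val.continuousAt
  have hproper : IsProperMap e := by
    refine isProperMap_iff_isCompact_preimage.2 ⟨hcont, fun L hL ↦ ?_⟩
    obtain ⟨C, hC⟩ := hL.exists_bound_of_continuousOn (f := fun w : T ↦ ((w : ℂ))⁻¹)
      (continuous_subtype_val.inv₀ fun w ↦ w.2.2).continuousOn
    obtain ⟨D, hD⟩ := hL.exists_bound_of_continuousOn (f := fun w : T ↦ (w : ℂ))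
      continuous_subtype_val.continuousOn
    have hD' : 0 < max D 1 := lt_max_of_lt_right one_pos
    have hK := isClosed_closedRegion.isClosedEmbedding_subtypeVal.isCompact_preimage
      (isCompact_closedRegion_annulus (inv_pos.2 hD') C)
    refine hK.of_isClosed_subset (hL.isClosed.preimage hcont) fun z hz ↦ ⟨z.2, ?_, ?_⟩
    · have h1 := hD _ hz
      rw [he] at h1
      rw [GTilde_eq_inv, norm_inv]
      have h2 : FTilde z ≠ 0 := (e z).2.2
      exact inv_anti₀ (norm_pos_iff.2 h2) (h1.trans (le_max_left _ _))
    · have h1 := hC _ hz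
      rwa [he, ← GTilde_eq_inv] at h1
  exact ⟨e.toHomeomorphOfContinuousClosed hcont hproper.isClosedMap, he⟩

/-! ### The boundary curve -/

lemma IsBoundaryPoint.GTilde_eq {x : ℝ} {z : ℂ} (hz : IsBoundaryPoint x z) :
    GTilde z = ((x⁻¹ : ℝ) : ℂ) := by
  rw [GTilde_eq_inv, hz.2.2.2, ofReal_inv]

lemma IsBoundaryPoint.GTilde_im {x : ℝ} {z : ℂ} (hz : IsBoundaryPoint x z) :
    (GTilde z).im = 0 := by
  rw [hz.GTilde_eq, ofReal_im]

lemma IsBoundaryPoint.mem_closedRegion {x : ℝ} {z : ℂ} (hz : IsBoundaryPoint x z) :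
    z ∈ closedRegion := ⟨hz.1, hz.GTilde_im.le⟩

lemma IsBoundaryPoint.eq {x : ℝ} {z w : ℂ} (hz : IsBoundaryPoint x z) (hw : IsBoundaryPoint x w) :
    z = w :=
  injOn_FTilde_closedRegion hz.mem_closedRegion hw.mem_closedRegion
    (hz.2.2.2.trans hw.2.2.2.symm)

lemma im_neg_of_GTilde_im_eq_zero {z : ℂ} (h : (GTilde z).im = 0) : z.im < 0 := by
  by_contra hy
  exact (GTilde_im_neg_of_im_nonneg (not_lt.1 hy)).ne h

lemma exists_isBoundaryPoint {x : ℝ} (hx : 0 < x) : ∃ z, IsBoundaryPoint x z := by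
  obtain ⟨z, hz, hzx⟩ := bijOn_FTilde_closedRegion.surjOn
    (show (x : ℂ) ∈ {w : ℂ | 0 ≤ w.im ∧ w ≠ 0} from ⟨by simp, by exact_mod_cast hx.ne'⟩)
  have hG : GTilde z = ((x⁻¹ : ℝ) : ℂ) := by rw [GTilde_eq_inv, hzx, ofReal_inv]
  refine ⟨z, hz.1, im_neg_of_GTilde_im_eq_zero (by rw [hG, ofReal_im]), ?_, hzx⟩
  have hpos : 0 < (GTilde z).re := by rw [hG, ofReal_re]; exact inv_pos.2 hx
  rcases lt_trichotomy z.re 0 with h | h | h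
  · have := GTilde_re_pos (z := -conj z) (by simpa) (neg_conj_mem_Xi.2 hz.1)
    rw [GTilde_neg_conj_re] at this
    linarith
  · exact absurd (GTilde_re_of_re_eq_zero h) hpos.ne'
  · exact h

lemma isBoundaryPoint_H {x : ℝ} (hx : 0 < x) : IsBoundaryPoint x (H x) :=
  Classical.epsilon_spec (exists_isBoundaryPoint hx)

/-- On each vertical line there is at most one zero of `Im G` in `Xi`. -/
lemma eq_of_re_eq_of_GTilde_im_eq_zero {z w : ℂ} (hz : z ∈ Xi) (hw : w ∈ Xi) (hre : z.re = w.re)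
    (hz0 : (GTilde z).im = 0) (hw0 : (GTilde w).im = 0) : z = w := by
  refine Complex.ext hre (le_antisymm ?_ ?_) <;> refine le_of_not_gt fun h ↦ ?_
  · exact (openRegion_of_lt_im ⟨hw, hw0.le⟩ hre h).2.ne hz0
  · exact (openRegion_of_lt_im ⟨hz, hz0.le⟩ hre.symm h).2.ne hw0

lemma bijOn_g : BijOn g (Ioi 0) (Ioi 0) := by
  refine ⟨fun x hx ↦ (isBoundaryPoint_H hx).2.2.1, fun a ha b hb hab ↦ ?_, fun r hr ↦ ?_⟩
  · have h1 := isBoundaryPoint_H ha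
    have h2 := isBoundaryPoint_H hb
    have h := h1.2.2.2
    rw [eq_of_re_eq_of_GTilde_im_eq_zero h1.1 h2.1 hab h1.GTilde_im h2.GTilde_im, h2.2.2.2] at h
    exact_mod_cast h.symm
  · obtain ⟨c, hc, hcX, hc0, -⟩ := exists_sign_change_height hr
    have hre := GTilde_re_pos (z := ⟨r, c⟩) hr hcX
    have hx := inv_pos.2 hre
    have hb : IsBoundaryPoint (GTilde ⟨r, c⟩).re⁻¹ ⟨r, c⟩ := by
      refine ⟨hcX, hc, hr, ?_⟩
      rw [FTilde_eq_inv, ofReal_inv]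
      congr 1
      exact Complex.ext rfl hc0
    refine ⟨_, hx, ?_⟩
    rw [g, (isBoundaryPoint_H hx).eq hb]

lemma f_abs (r : ℝ) : f |r| = f r := by simp [f]

/-- The graph of `f` consists of the zeros of `Im G` in `Xi`. -/
lemma f_spec {r : ℝ} (hr : r ≠ 0) : (⟨r, f r⟩ : ℂ) ∈ Xi ∧ (GTilde ⟨r, f r⟩).im = 0 := by
  have key {r : ℝ} (hr : 0 < r) : (⟨r, f r⟩ : ℂ) ∈ Xi ∧ (GTilde ⟨r, f r⟩).im = 0 := by
    have hr' : r ∈ g '' Ioi 0 := bijOn_g.surjOn hr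
    have hH := isBoundaryPoint_H (Function.invFunOn_mem hr')
    have heq : (⟨r, f r⟩ : ℂ) = H (Function.invFunOn g (Ioi 0) r) := by
      refine Complex.ext (Function.invFunOn_eq hr').symm ?_
      simp [f, h, abs_of_pos hr]
    rw [heq]
    exact ⟨hH.1, hH.GTilde_im⟩
  rcases hr.lt_or_gt with hr | hr
  · have h := key (r := -r) (by linarith)
    have heq : (⟨-r, f (-r)⟩ : ℂ) = -conj ⟨r, f r⟩ := by
      refine Complex.ext (by simp) ?_
      rw [← f_abs (-r), abs_neg, f_abs]
      simp
    rwa [heq, neg_conj_mem_Xi, GTilde_neg_conj_im] at h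
  · exact key hr

lemma f_neg {r : ℝ} (hr : r ≠ 0) : f r < 0 := im_neg_of_GTilde_im_eq_zero (f_spec hr).2

lemma eq_f_of_GTilde_im_eq_zero {r y : ℝ} (hr : r ≠ 0) (hX : (⟨r, y⟩ : ℂ) ∈ Xi)
    (h0 : (GTilde ⟨r, y⟩).im = 0) : y = f r :=
  congrArg im (eq_of_re_eq_of_GTilde_im_eq_zero hX (f_spec hr).1 rfl h0 (f_spec hr).2)

lemma Omega_eq_openRegion : Omega = openRegion := by
  ext z
  constructor
  · rintro (⟨hr, hf⟩ | hr)
    · exact openRegion_of_lt_im (z := ⟨z.re, f z.re⟩) ⟨(f_spec hr).1, (f_spec hr).2.le⟩ rfl hf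
    · exact openRegion_of_re_eq_zero hr
  · intro hz
    rcases eq_or_ne z.re 0 with hr | hr
    · exact Or.inr hr
    · refine Or.inl ⟨hr, lt_of_not_ge fun hle ↦ ?_⟩
      rcases hle.lt_or_eq with hlt | heq
      · exact (openRegion_of_lt_im (w := ⟨z.re, f z.re⟩) (openRegion_subset hz) rfl hlt).2.ne
          (f_spec hr).2
      · have h0 := (f_spec hr).2
        rw [← heq] at h0
        exact hz.2.ne h0

lemma closure_Omega : closure Omega = closedRegion := by
  rw [Omega_eq_openRegion, closure_openRegion]

/-- On the boundary curve the vertical derivative of `Im G` does not vanish. -/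
lemma vertical_deriv_ne_zero {r : ℝ} (hr : r ≠ 0) :
    (1 - ⟨r, f r⟩ * GTilde ⟨r, f r⟩ : ℂ).re ≠ 0 := by
  have key {z : ℂ} (hx : 0 < z.re) (hX : z ∈ Xi) (h0 : (GTilde z).im = 0) :
      (1 - z * GTilde z).re ≠ 0 := by
    have hy := im_neg_of_GTilde_im_eq_zero h0
    have h := one_lt_re_mul_GTilde_re hx hy (neg_lt_pi_of_mem_Xi hX hy) h0
    rw [sub_re, one_re, mul_re, h0, mul_zero, sub_zero]
    linarith
  obtain ⟨hX, h0⟩ := f_spec hr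
  rcases hr.lt_or_gt with hr | hr
  · have h := key (z := -conj ⟨r, f r⟩) (by simpa) (neg_conj_mem_Xi.2 hX)
      (by rwa [GTilde_neg_conj_im])
    rw [GTilde_neg_conj, neg_mul_neg, ← map_mul, sub_re, conj_re, ← sub_re] at h
    exact h
  · exact key hr hX h0

/-- The analytic implicit function theorem applied to `Im G(x + iy) = 0`. -/
lemma analyticAt_f {r : ℝ} (hr : r ≠ 0) : AnalyticAt ℝ f r := by
  set Φ : ℝ × ℝ → ℝ := fun p ↦ (GTilde (p.1 + p.2 * I)).im with hΦ
  have hmk (x y : ℝ) : (x + y * I : ℂ) = ⟨x, y⟩ := by apply Complex.ext <;> simp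
  have hsmooth : ContDiff ℝ ω Φ := by
    have h1 : ContDiff ℝ ω GTilde := differentiable_GTilde.contDiff.restrict_scalars ℝ
    have h2 : ContDiff ℝ ω fun p : ℝ × ℝ ↦ (p.1 + p.2 * I : ℂ) :=
      (ofRealCLM.contDiff.comp contDiff_fst).add
        ((ofRealCLM.contDiff.comp contDiff_snd).mul contDiff_const)
    exact imCLM.contDiff.comp (h1.comp h2)
  have hΦ0 : Φ (r, f r) = 0 := by
    simp only [hΦ, hmk]; exact (f_spec hr).2
  set d := (1 - ⟨r, f r⟩ * GTilde ⟨r, f r⟩ : ℂ).re with hd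
  have hd0 : d ≠ 0 := vertical_deriv_ne_zero hr
  have hinv : (fderiv ℝ Φ (r, f r) ∘L .inr ℝ ℝ ℝ).IsInvertible := by
    refine ⟨ContinuousLinearEquiv.unitsEquivAut ℝ (Units.mk0 d hd0), ?_⟩
    have h1 : HasFDerivAt (fun y : ℝ ↦ Φ (r, y))
        (fderiv ℝ Φ (r, f r) ∘L .inr ℝ ℝ ℝ) (f r) :=
      ((hsmooth.differentiable (by simp)).differentiableAt.hasFDerivAt).comp (f r)
        (hasFDerivAt_prodMk_right r (f r))
    have h2 : HasDerivAt (fun y : ℝ ↦ Φ (r, y)) d (f r) := by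
      simp only [hΦ, hmk]
      exact hasDerivAt_GTilde_im_vertical r (f r)
    rw [h1.unique h2.hasFDerivAt]
    ext
    simp
  have hc : ContDiffAt ℝ ω Φ (r, f r) := hsmooth.contDiffAt
  have hω : (ω : WithTop ℕ∞) ≠ 0 := by simp
  set ψ := hc.implicitFunction hω hinv with hψ
  have hψa : ContDiffAt ℝ ω ψ r := hc.contDiffAt_implicitFunction hω hinv
  have hψr : ψ r = f r := hc.implicitFunction_apply_self hω hinv
  have hev : ∀ᶠ x in 𝓝 r, Φ (x, ψ x) = 0 := by
    have := hc.eventually_apply_implicitFunction hω hinv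
    rwa [hΦ0] at this
  have hX : ∀ᶠ x : ℝ in 𝓝 r, (x + ψ x * I : ℂ) ∈ Xi := by
    have hcont : ContinuousAt (fun x : ℝ ↦ (x + ψ x * I : ℂ)) r := by
      have := hψa.continuousAt
      fun_prop
    refine hcont.eventually_mem (isOpen_Xi.mem_nhds ?_)
    rw [hψr, hmk]
    exact (f_spec hr).1
  refine hψa.analyticAt.congr ?_
  filter_upwards [hev, hX, isOpen_ne.mem_nhds hr] with x h1 h2 h3
  simp only [hΦ, hmk] at h1 h2
  exact eq_f_of_GTilde_im_eq_zero h3 h2 h1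

lemma isUIExtension_FTilde : IsUIExtension (gaussianReal 0 1) Omega FTilde := by
  rw [Omega_eq_openRegion]
  exact
    { isOpen := isOpen_openRegion
      isConnected := isConnected_openRegion
      upperHalf_subset := upperHalf_subset_openRegion
      eqOn := fun z (hz : 0 < z.im) ↦ by
        rw [FTilde, recipCauchyTransform, GTilde_eq_cauchyTransform hz]
      analytic := fun z hz ↦ analyticAt_FTilde hz.1
      bijOn := bijOn_FTilde_openRegion }

end NormalUI

end

theorem theorem2 :
    -- `GTilde` is the entire continuation of the Cauchy transform of `N(0,1)`
    (Differentiable ℂ NormalUI.GTilde ∧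
      EqOn NormalUI.GTilde (NormalUI.cauchyTransform (gaussianReal 0 1)) NormalUI.upperHalf ∧
      MeromorphicOn NormalUI.FTilde univ) ∧
    -- `H`, `g⁻¹` are well defined
    (∀ x : ℝ, 0 < x →
      NormalUI.IsBoundaryPoint x (NormalUI.H x) ∧
      ∀ z : ℂ, NormalUI.IsBoundaryPoint x z → z = NormalUI.H x) ∧
    BijOn NormalUI.g (Ioi 0) (Ioi 0) ∧
    -- `f` is real analytic and negative on `ℝ ∖ {0}`
    AnalyticOnNhd ℝ NormalUI.f {x : ℝ | x ≠ 0} ∧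
    (∀ x : ℝ, x ≠ 0 → NormalUI.f x < 0) ∧
    -- `Ω` is a domain as required for class **UI**, through the function `FTilde`
    NormalUI.IsUIExtension (gaussianReal 0 1) NormalUI.Omega NormalUI.FTilde ∧
    NormalUI.ClassUI (gaussianReal 0 1) ∧
    -- `FTilde` is pole free on `cl(Ω)` and a homeomorphism onto `(ℂ⁺ ∪ ℝ) ∖ {0}`
    (∀ z ∈ closure NormalUI.Omega, NormalUI.GTilde z ≠ 0) ∧
    (∃ e : (closure NormalUI.Omega : Set ℂ) ≃ₜ {w : ℂ | 0 ≤ w.im ∧ w ≠ 0},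
      ∀ z : (closure NormalUI.Omega : Set ℂ), (e z : ℂ) = NormalUI.FTilde (z : ℂ)) := by
  have hui := NormalUI.isUIExtension_FTilde
  refine ⟨⟨NormalUI.differentiable_GTilde, fun z hz ↦ NormalUI.GTilde_eq_cauchyTransform hz,
      fun z _ ↦ ?_⟩,
    fun x hx ↦ ⟨NormalUI.isBoundaryPoint_H hx, fun z hz ↦ hz.eq (NormalUI.isBoundaryPoint_H hx)⟩,
    NormalUI.bijOn_g, fun x hx ↦ NormalUI.analyticAt_f hx, fun x hx ↦ NormalUI.f_neg hx, hui,
    ⟨_, _, hui⟩, fun z hz ↦ ?_, ?_⟩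
  · exact (MeromorphicAt.const 1 z).div
      (NormalUI.differentiable_GTilde.analyticAt z).meromorphicAt
  · rw [NormalUI.closure_Omega] at hz
    exact NormalUI.GTilde_ne_zero hz.1
  · rw [NormalUI.closure_Omega]
    exact NormalUI.exists_homeomorph_closedRegion
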